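/- Let $H^\infty$ be the algebra of bounded holomorphic functions on the open unit disc $\mathbb{D}$, with the supremum norm. Let $T$ be a completely non-unitary contraction on a complex Hilbert space $\mathcal{H}$. For $u(z)=\sum_n a_nz^n\in H^\infty$ let $u(T)=\lim_{r\to1^-}\sum_n a_nr^nT^n$ (strong limit) denote the Sz.-Nagy–Foias functional calculus. Assume that $T$ is of class $C_0$, i.e. $u(T)=0$ for some nonzero $u\in H^\infty$, and that $T$ has minimal function $\theta$, i.e. $\theta$ is inner and $\{u\in H^\infty:u(T)=0\}=\theta H^\infty$. Assume that $\theta=\prod_{n\in\mathbb{N}}\theta_n$ (the partial products converging pointwise, equivalently locally uniformly, on $\mathbb{D}$), where the $\theta_n$ are inner functions; for $A\subset\mathbb{N}$ write $\theta_A=\prod_{n\in A}\theta_n$. Assume that $\{\theta_n\}_n$ satisfies the generalized Carleson condition with constant $C>0$: for every finite $A\subset\mathbb{N}$ there are $f_A,g_A\in H^\infty$ with $$f_A\theta_A+g_A\frac{\theta}{\theta_A}=1,\qquad \|f_A\|_{H^\infty}\le C,\quad \|g_A\|_{H^\infty}\le C.\tag{1}$$ Then for every finite or cofinite $A\subset\mathbb{N}$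 the product $\theta_A$ converges to a nonzero element of $H^\infty$ dividing $\theta$, and there are $f_A,g_A\in H^\infty$ satisfying (1). For any $f_A,g_A\in H^\infty$ that satisfy the identity in (1) (with or without the norm bounds), put $$\phi_A=g_A\frac{\theta}{\theta_A},\qquad k_A=2\phi_A(T)-I .$$ The operators $\phi_A(T)$ and $k_A$ exist and do not depend on the choice of $f_A,g_A$. Moreover, for all finite or cofinite $A,B\subset\mathbb{N}$, $$\phi_A(T)\phi_B(T)=\phi_{A\cap B}(T),\qquad k_A^2=I\ (\text{that is, } k_A=k_A^{-1}),\qquad k_Ak_B=k_{\mathbb{N}\setminus(A\triangle B)},$$ where $A\triangle B=(A\setminus B)\cup(B\setminus A)$, and $\{k_A: A\subset\mathbb{N}\text{ finite or cofinite}\}$ is an abelian subgroup of the group of invertible elements of $B(\mathcal{H})$. -/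

import Mathlib

open Filter Topology MeasureTheory
open scoped symmDiff

noncomputable section

/-- The open unit disc of the complex plane, as a type. -/
abbrev OpenDisc : Type := Metric.ball (0 : ℂ) 1

/-- Extension by zero of a function on the open unit disc to the whole plane. -/
def zeroExt (f : OpenDisc → ℂ) : ℂ → ℂ := fun z =>
  open Classical in if h : z ∈ Metric.ball (0 : ℂ) 1 then f ⟨z, h⟩ else 0

theorem zeroExt_eq_of_mem (f : OpenDisc → ℂ) {z : ℂ} (h : z ∈ Metric.ball (0 : ℂ) 1) :
    zeroExt f z = f ⟨z, h⟩ := dif_pos h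

/-- The algebra of bounded holomorphic functions on the open unit disc, with the pointwise
operations. -/
def hInftyAlgebra : Subalgebra ℂ (OpenDisc → ℂ) where
  carrier := {f | DifferentiableOn ℂ (zeroExt f) (Metric.ball 0 1) ∧ ∃ M : ℝ, ∀ z, ‖f z‖ ≤ M}
  mul_mem' := by
    rintro f g ⟨hf, M, hM⟩ ⟨hg, N, hN⟩
    refine ⟨(hf.mul hg).congr fun z hz => ?_, M * N, fun z => ?_⟩
    · simp [zeroExt_eq_of_mem _ hz]
    · rw [Pi.mul_apply, norm_mul]
      exact mul_le_mul (hM z) (hN z) (norm_nonneg _) ((norm_nonneg _).trans (hM z))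
  add_mem' := by
    rintro f g ⟨hf, M, hM⟩ ⟨hg, N, hN⟩
    refine ⟨(hf.add hg).congr fun z hz => ?_, M + N, fun z => ?_⟩
    · simp [zeroExt_eq_of_mem _ hz]
    · exact (norm_add_le _ _).trans (add_le_add (hM z) (hN z))
  algebraMap_mem' := by
    intro c
    refine ⟨(differentiableOn_const c).congr fun z hz => ?_, ‖c‖, fun z => le_rfl⟩
    simp [zeroExt_eq_of_mem _ hz]

/-- The space `H^∞` of bounded holomorphic functions on the open unit disc. Divisibility `u ∣ v`
in this ring is: `v = u * f` for some `f` in `H^∞`. -/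
abbrev HInfty : Type := hInftyAlgebra

/-- The supremum norm on `H^∞`. -/
def supNorm (u : HInfty) : ℝ := ⨆ z : OpenDisc, ‖u.1 z‖

/-- Inner functions: bounded by one on the disc, with radial boundary values of modulus one almost
everywhere on the unit circle. -/
def IsInner (u : HInfty) : Prop :=
  (∀ z, ‖u.1 z‖ ≤ 1) ∧
    ∀ᵐ t : ℝ, ∃ c : ℂ, ‖c‖ = 1 ∧
      Tendsto (fun r : ℝ => zeroExt u.1 (r * Complex.exp (t * Complex.I))) (𝓝[<] 1) (𝓝 c)

/-- The `n`-th Taylor coefficient of `u` at the origin. -/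
def taylorCoeff (u : HInfty) (n : ℕ) : ℂ := iteratedDeriv n (zeroExt u.1) 0 / (n.factorial : ℂ)

/-- `u` is the product of the `θ n` over `n ∈ A`: at every point of the disc the partial products,
taken in the natural order, converge to `u`. (For functions bounded by one, such as inner functions,
this is the same as locally uniform convergence.) -/
def IsProductOver (θ : ℕ → HInfty) (A : Set ℕ) (u : HInfty) : Prop :=
  open Classical in
  ∀ z : OpenDisc, Tendsto (fun N : ℕ => ∏ n ∈ (Finset.range N).filter (· ∈ A), (θ n).1 z)
    atTop (𝓝 (u.1 z))

/-- The product `θ_A` of the `θ n` over `n ∈ A` (zero if it does not converge in `H^∞`). -/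
def thetaProd (θ : ℕ → HInfty) (A : Set ℕ) : HInfty :=
  open Classical in if h : ∃ u, IsProductOver θ A u then h.choose else 0

/-- The quotient `u / v` in `H^∞`, for `v ≠ 0` dividing `u` (zero if `v` does not divide `u`). -/
def hInftyQuot (u v : HInfty) : HInfty :=
  open Classical in if h : v ∣ u then h.choose else 0

/-- The quotient `θ / θ_A`, where `θ` is the full product. -/
def coTheta (θ : ℕ → HInfty) (A : Set ℕ) : HInfty :=
  hInftyQuot (thetaProd θ Set.univ) (thetaProd θ A)

/-- The identity `f θ_A + g (θ / θ_A) = 1`. -/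
def IsBezoutPair (θ : ℕ → HInfty) (A : Set ℕ) (f g : HInfty) : Prop :=
  f * thetaProd θ A + g * coTheta θ A = 1

/-- The generalized Carleson condition with constant `C`. -/
def GeneralizedCarleson (θ : ℕ → HInfty) (C : ℝ) : Prop :=
  0 < C ∧ ∀ A : Set ℕ, A.Finite →
    ∃ f g : HInfty, IsBezoutPair θ A f g ∧ supNorm f ≤ C ∧ supNorm g ≤ C

/-- Finite or cofinite sets of natural numbers. -/
def FinOrCofin (A : Set ℕ) : Prop := A.Finite ∨ Aᶜ.Finite

section Operators

variable {H : Type*} [NormedAddCommGroup H] [InnerProductSpace ℂ H] [CompleteSpace H]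

/-- `T` is completely non-unitary: the only closed subspace that reduces `T` and on which `T` acts as
a unitary operator is the zero subspace. -/
def IsCompletelyNonUnitary (T : H →L[ℂ] H) : Prop :=
  ∀ M : Submodule ℂ H, IsClosed (M : Set H) →
    (∀ x ∈ M, T x ∈ M) → (∀ x ∈ M, ContinuousLinearMap.adjoint T x ∈ M) →
    (∀ x ∈ M, ContinuousLinearMap.adjoint T (T x) = x ∧ T (ContinuousLinearMap.adjoint T x) = x) →
    M = ⊥

/-- The operator `u(rT) = ∑ aₙ rⁿ Tⁿ`, where the `aₙ` are the Taylor coefficients of `u`. The series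
converges absolutely in operator norm when `T` is a contraction and `0 ≤ r < 1`. -/
def dilatedEval (T : H →L[ℂ] H) (u : HInfty) (r : ℝ) : H →L[ℂ] H :=
  ∑' n : ℕ, (taylorCoeff u n * (r : ℂ) ^ n) • T ^ n

/-- `X = u(T)` in the Sz.-Nagy--Foias functional calculus: `X` is the limit of `u(rT)` in the strong
operator topology as `r` increases to one. -/
def IsHInftyValue (T : H →L[ℂ] H) (u : HInfty) (X : H →L[ℂ] H) : Prop :=
  ∀ x : H, Tendsto (fun r : ℝ => dilatedEval T u r x) (𝓝[<] 1) (𝓝 (X x))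

/-- The operator `u(T)` of the Sz.-Nagy--Foias functional calculus (zero if the strong limit that
defines it does not exist). -/
def hInftyCalc (T : H →L[ℂ] H) (u : HInfty) : H →L[ℂ] H :=
  open Classical in if h : ∃ X, IsHInftyValue T u X then h.choose else 0

/-- The class `C₀`: completely non-unitary contractions `T` such that `u(T) = 0` for some nonzero
`u` in `H^∞`. -/
def IsClassC0 (T : H →L[ℂ] H) : Prop :=
  ‖T‖ ≤ 1 ∧ IsCompletelyNonUnitary T ∧ ∃ u : HInfty, u ≠ 0 ∧ IsHInftyValue T u 0

/-- `m` is a minimal function of `T`: it is inner, and the `u` in `H^∞` with `u(T) = 0` are exactly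
the multiples of `m`. -/
def IsMinimalFunction (T : H →L[ℂ] H) (m : HInfty) : Prop :=
  IsInner m ∧ ∀ u : HInfty, IsHInftyValue T u 0 ↔ m ∣ u

/-- The operator `φ_A(T)`, where `φ_A = g_A θ / θ_A`. -/
def phiOp (T : H →L[ℂ] H) (θ : ℕ → HInfty) (g : Set ℕ → HInfty) (A : Set ℕ) : H →L[ℂ] H :=
  hInftyCalc T (g A * coTheta θ A)

/-- The operator `k_A = 2 φ_A(T) - I`. -/
def kOp (T : H →L[ℂ] H) (θ : ℕ → HInfty) (g : Set ℕ → HInfty) (A : Set ℕ) : H →L[ℂ] H :=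
  (2 : ℂ) • phiOp T θ g A - 1

end Operators

end

/-! Modulo `θ` the algebra is the Chinese remainder theorem. `φ_A` is 1 modulo `θ_A` and 0 modulo `θ
/ θ_A = θ_{Aᶜ}`, so modulo `θ` it does not depend on the Bezout pair and behaves like the indicator
of `A`: products go to intersections and `1 - φ_A` to the complement. Since `θ(T) = 0`, the `φ_A(T)`
are commuting idempotents, and `k_A = 2 φ_A(T) - 1` takes the "values" 1 on `A` and -1 off `A`;
multiplying such signs gives the sign function of the complement of `A ∆ B`. The carriers are
`coTheta_eq`, `phiOp_mul_phiOp` and `phiOp_compl`.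

The analytic work is to show that `u(T)` exists and is multiplicative. No unitary dilation is used.
Parseval's identity on the circle is transferred to orbits of `T` (`exists_sum_norm_sq_orbit_le`),
which yields von Neumann's inequality and a version of it for the seminorm `lim ‖Tⁿ x‖`. If `u(T) =
0` with `u ≠ 0`, polynomials close to `u` nearly annihilate any given vector; a peak-function
construction then makes the strong limit `A` of `T*ⁿ Tⁿ` commute with `T` and makes `T` unitary on
the closure of the range of `A`. Complete non-unitarity forces `A = 0`, that is `Tⁿ → 0` strongly
(`IsClassC0.tendsto_pow`). For such contractions the radial limits exist by a Cauchy argument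
(`cauchy_dilatedEval`).

For cofinite `A` the convergence of `θ_A` comes from dividing the full product by a finite one
(`HInfty.exists_tendsto_of_mul`). -/

noncomputable section

/-! ### Parseval's identity for vector-valued polynomials on the circle. -/

section Parseval

variable {H : Type*} [NormedAddCommGroup H] [InnerProductSpace ℂ H]

theorem integral_conj_fourier_mul_fourier (m n : ℤ) :
    ∫ t : UnitAddCircle, fourier (-m) t * fourier n t ∂AddCircle.haarAddCircle
      = if m = n then 1 else 0 := by
  have h := congrFun (fourierCoeff_fourier (T := 1) n) m
  rw [fourierCoeff] at h
  simp only [smul_eq_mul] at h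
  rw [h, Pi.single_apply]

/-- Parseval's identity for analytic trigonometric polynomials with coefficients in an inner product
space. -/
theorem integral_norm_sq_sum_fourier (s : Finset ℕ) (a : ℕ → H) :
    ∫ t : UnitAddCircle, ‖∑ n ∈ s, (fourier 1 t : ℂ) ^ n • a n‖ ^ 2 ∂AddCircle.haarAddCircle
      = ∑ n ∈ s, ‖a n‖ ^ 2 := by
  have hpow : ∀ (n : ℕ) (t : UnitAddCircle), (fourier 1 t : ℂ) ^ n = fourier (n : ℤ) t := by
    intro n t
    induction n with
    | zero => simp
    | succ k ih => rw [pow_succ, ih, Nat.cast_succ, fourier_add]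
  have key : ∀ t : UnitAddCircle, ((‖∑ n ∈ s, (fourier 1 t : ℂ) ^ n • a n‖ ^ 2 : ℝ) : ℂ)
      = ∑ m ∈ s, ∑ n ∈ s, (fourier (-(m : ℤ)) t * fourier (n : ℤ) t) * inner ℂ (a m) (a n) := by
    intro t
    have := inner_self_eq_norm_sq_to_K (𝕜 := ℂ) (∑ n ∈ s, (fourier 1 t : ℂ) ^ n • a n)
    push_cast
    rw [← Complex.coe_algebraMap, ← RCLike.algebraMap_eq_ofReal] at *
    erw [← this]
    rw [sum_inner]
    refine Finset.sum_congr rfl fun m _ => ?_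
    rw [inner_sum]
    refine Finset.sum_congr rfl fun n _ => ?_
    rw [inner_smul_left, inner_smul_right, hpow, hpow, fourier_neg, mul_assoc]
  have hint : ∀ m n : ℕ, Integrable (fun t : UnitAddCircle =>
      (fourier (-(m : ℤ)) t * fourier (n : ℤ) t) * inner ℂ (a m) (a n))
      AddCircle.haarAddCircle := by
    intro m n
    have hc : Continuous (fun t : UnitAddCircle =>
      (fourier (-(m : ℤ)) t * fourier (n : ℤ) t) * inner ℂ (a m) (a n)) := by fun_prop
    exact hc.integrable_of_hasCompactSupport (HasCompactSupport.of_compactSpace _)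
  have : ((∫ t : UnitAddCircle, ‖∑ n ∈ s, (fourier 1 t : ℂ) ^ n • a n‖ ^ 2
      ∂AddCircle.haarAddCircle : ℝ) : ℂ) = ((∑ n ∈ s, ‖a n‖ ^ 2 : ℝ) : ℂ) := by
    rw [← integral_complex_ofReal]
    simp_rw [key]
    rw [integral_finsetSum _ fun m _ => integrable_finsetSum _ fun n _ => hint m n]
    push_cast
    refine Finset.sum_congr rfl fun m hm => ?_
    rw [integral_finsetSum _ fun n _ => hint m n]
    simp_rw [integral_mul_const, integral_conj_fourier_mul_fourier]
    simp only [Nat.cast_inj, ite_mul, one_mul, zero_mul, Finset.sum_ite_eq, hm, if_true]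
    exact inner_self_eq_norm_sq_to_K (a m)
  exact_mod_cast this

theorem PolynomialModule.eval_eq_sum_of_subset (a : PolynomialModule ℂ H) {s : Finset ℕ}
    (hs : a.coeff.support ⊆ s) (z : ℂ) :
    PolynomialModule.eval z a = ∑ n ∈ s, z ^ n • a.coeff n :=
  Finsupp.sum_of_support_subset _ hs _ fun _ _ => smul_zero _

/-- If `|f|² ≤ α + β |v|²` on the unit circle, then multiplication by `f` is controlled by
multiplication by `v` on polynomials with vector coefficients, in the `ℓ²` norm. -/
theorem sum_norm_sq_coeff_smul_le {f v : Polynomial ℂ} {α β : ℝ}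
    (h : ∀ z : ℂ, ‖z‖ = 1 → ‖f.eval z‖ ^ 2 ≤ α + β * ‖v.eval z‖ ^ 2)
    (a : PolynomialModule ℂ H) {s : Finset ℕ} (ha : a.coeff.support ⊆ s)
    (hf : (f • a).coeff.support ⊆ s) (hv : (v • a).coeff.support ⊆ s) :
    ∑ n ∈ s, ‖(f • a).coeff n‖ ^ 2
      ≤ α * ∑ n ∈ s, ‖a.coeff n‖ ^ 2 + β * ∑ n ∈ s, ‖(v • a).coeff n‖ ^ 2 := by
  rw [← integral_norm_sq_sum_fourier, ← integral_norm_sq_sum_fourier,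
    ← integral_norm_sq_sum_fourier, ← integral_const_mul, ← integral_const_mul]
  have hint : ∀ (b : ℕ → H) (c : ℝ), Integrable (fun t : UnitAddCircle =>
      c * ‖∑ n ∈ s, (fourier 1 t : ℂ) ^ n • b n‖ ^ 2) AddCircle.haarAddCircle := by
    intro b c
    have hc : Continuous (fun t : UnitAddCircle =>
      c * ‖∑ n ∈ s, (fourier 1 t : ℂ) ^ n • b n‖ ^ 2) := by fun_prop
    exact hc.integrable_of_hasCompactSupport (HasCompactSupport.of_compactSpace _)
  rw [← integral_add (hint _ _) (hint _ _)]
  refine integral_mono (by simpa using hint _ 1) ((hint _ _).add (hint _ _)) fun t => ?_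
  have ht : ‖(fourier 1 t : ℂ)‖ = 1 := by rw [fourier_apply]; exact Circle.norm_coe _
  simp only [← PolynomialModule.eval_eq_sum_of_subset _ ha,
    ← PolynomialModule.eval_eq_sum_of_subset _ hf,
    ← PolynomialModule.eval_eq_sum_of_subset _ hv, PolynomialModule.eval_smul, norm_smul, mul_pow]
  -- The scalar hypothesis is multiplied pointwise by `‖a(z)‖²`; integrating over the circle gives
  -- the claim.
  have := mul_le_mul_of_nonneg_right (h _ ht)
    (sq_nonneg ‖PolynomialModule.eval (fourier 1 t : ℂ) a‖)
  linarith

end Parseval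

/-! ### From polynomials on the circle to orbits of a contraction. -/

section Orbit

variable {H : Type*} [NormedAddCommGroup H] [InnerProductSpace ℂ H]

/-- The polynomial with coefficients `D T^L x, …, D T x, D x`. -/
def orbitPolynomial (T D : H →L[ℂ] H) (x : H) (L : ℕ) : PolynomialModule ℂ H :=
  PolynomialModule.ofCoeff ℂ
    (Finsupp.onFinset (Finset.range (L + 1)) (fun j => if j < L + 1 then D ((T ^ (L - j)) x) else 0)
      (by intro j hj; by_contra h; simp at h; exact hj (if_neg (by omega))))

theorem coeff_orbitPolynomial (T D : H →L[ℂ] H) (x : H) (L j : ℕ) :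
    (orbitPolynomial T D x L).coeff j = if j < L + 1 then D ((T ^ (L - j)) x) else 0 := rfl

theorem coeff_smul_eq_sum (f : Polynomial ℂ) (a : PolynomialModule ℂ H) {d : ℕ}
    (hd : f.natDegree ≤ d) (n : ℕ) :
    (f • a).coeff n
      = ∑ i ∈ Finset.range (d + 1), if i ≤ n then f.coeff i • a.coeff (n - i) else 0 := by
  conv_lhs => rw [f.as_sum_range' (d + 1) (by omega)]
  rw [Finset.sum_smul, PolynomialModule.coeff_sum, Finsupp.finsetSum_apply]
  simp only [PolynomialModule.monomial_smul_apply]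

/-- The orbit is stored in reverse order, so convolution with the coefficients of `f` raises the
power of `T`: degree `L - m` collects `∑ fᵢ D T^(m+i) x`. The condition `m + d ≤ L` keeps every
index within the stored orbit. -/
theorem coeff_smul_orbitPolynomial (f : Polynomial ℂ) (T D : H →L[ℂ] H) (x : H) {d L m : ℕ}
    (hd : f.natDegree ≤ d) (hm : m + d ≤ L) :
    (f • orbitPolynomial T D x L).coeff (L - m) = D ((T ^ m) (Polynomial.aeval T f x)) := by
  rw [coeff_smul_eq_sum f _ hd, Polynomial.aeval_eq_sum_range' (n := d + 1) (by omega)]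
  rw [sum_apply, map_sum, map_sum]
  refine Finset.sum_congr rfl fun i hi => ?_
  rw [Finset.mem_range] at hi
  rw [if_pos (by omega), coeff_orbitPolynomial, if_pos (by omega)]
  rw [smul_apply, map_smul, map_smul, ← mul_apply_eq_comp (T ^ m),
    ← pow_add]
  congr 4
  omega

theorem support_smul_orbitPolynomial (f : Polynomial ℂ) (T D : H →L[ℂ] H) (x : H) {d L : ℕ}
    (hd : f.natDegree ≤ d) :
    (f • orbitPolynomial T D x L).coeff.support ⊆ Finset.range (L + d + 1) := by
  intro n hn
  rw [Finsupp.mem_support_iff] at hn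
  by_contra h
  rw [Finset.mem_range] at h
  apply hn
  rw [coeff_smul_eq_sum f _ hd]
  refine Finset.sum_eq_zero fun i hi => ?_
  rw [Finset.mem_range] at hi
  split_ifs with hin
  · rw [coeff_orbitPolynomial, if_neg (by omega), smul_zero]
  · rfl

theorem norm_pow_apply_le {T : H →L[ℂ] H} (hT : ‖T‖ ≤ 1) (n : ℕ) (x : H) :
    ‖(T ^ n) x‖ ≤ ‖x‖ := by
  induction n with
  | zero => simp
  | succ k ih =>
    rw [pow_succ', mul_apply_eq_comp]
    exact (T.le_of_opNorm_le hT _).trans (by simpa using ih)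

theorem norm_coeff_smul_orbitPolynomial_le (f : Polynomial ℂ) {T : H →L[ℂ] H} (hT : ‖T‖ ≤ 1)
    (D : H →L[ℂ] H) (x : H) {d L : ℕ} (hd : f.natDegree ≤ d) (n : ℕ) :
    ‖(f • orbitPolynomial T D x L).coeff n‖
      ≤ ∑ i ∈ Finset.range (d + 1), ‖f.coeff i‖ * (‖D‖ * ‖x‖) := by
  rw [coeff_smul_eq_sum f _ hd]
  refine (norm_sum_le _ _).trans (Finset.sum_le_sum fun i _ => ?_)
  split_ifs with h
  · rw [norm_smul, coeff_orbitPolynomial]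
    refine mul_le_mul_of_nonneg_left ?_ (norm_nonneg _)
    split_ifs
    · exact (D.le_opNorm _).trans
        (mul_le_mul_of_nonneg_left (norm_pow_apply_le hT _ _) (norm_nonneg _))
    · rw [norm_zero]; positivity
  · rw [norm_zero]; positivity

/-- Only the `M + 1` middle degrees of a product with the orbit polynomial are orbit terms; the `d`
lowest and `d` highest are boundary terms. -/
theorem sum_range_eq_three (g : ℕ → ℝ) (M d : ℕ) :
    ∑ n ∈ Finset.range (M + d + d + 1), g n
      = ∑ n ∈ Finset.range d, g n + ∑ m ∈ Finset.range (M + 1), g (M + d - m)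
        + ∑ n ∈ Finset.range d, g (M + d + 1 + n) := by
  rw [show M + d + d + 1 = (d + (M + 1)) + d by ring, Finset.sum_range_add, Finset.sum_range_add]
  congr 1
  · congr 1
    rw [← Finset.sum_range_reflect]
    refine Finset.sum_congr rfl fun m hm => ?_
    rw [Finset.mem_range] at hm
    congr 1; omega
  · refine Finset.sum_congr rfl fun m hm => ?_
    congr 1; omega

/-- Transfer of the inequality `|f|² ≤ α + β |v|²` on the unit circle to orbits of a contraction. -/
theorem exists_sum_norm_sq_orbit_le {f v : Polynomial ℂ} {α β : ℝ} (hβ : 0 ≤ β)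
    (h : ∀ z : ℂ, ‖z‖ = 1 → ‖f.eval z‖ ^ 2 ≤ α + β * ‖v.eval z‖ ^ 2)
    {T : H →L[ℂ] H} (hT : ‖T‖ ≤ 1) (D : H →L[ℂ] H) (x : H) {d : ℕ}
    (hf : f.natDegree ≤ d) (hv : v.natDegree ≤ d) :
    ∃ K : ℝ, ∀ M : ℕ,
      ∑ m ∈ Finset.range (M + 1), ‖D ((T ^ m) (Polynomial.aeval T f x))‖ ^ 2
        ≤ α * ∑ k ∈ Finset.range (M + d + 1), ‖D ((T ^ k) x)‖ ^ 2
          + β * (∑ m ∈ Finset.range (M + 1), ‖D ((T ^ m) (Polynomial.aeval T v x))‖ ^ 2 + K) := by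
  -- `B` bounds each squared boundary coefficient of the product with `v`, independently of `M`. The
  -- `2d` of them make up `K`; those of the product with `f` are nonnegative and are dropped.
  set B : ℝ := (∑ i ∈ Finset.range (d + 1), ‖v.coeff i‖ * (‖D‖ * ‖x‖)) ^ 2 with hB
  refine ⟨d * B + d * B, fun M => ?_⟩
  have ha : (orbitPolynomial T D x (M + d)).coeff.support ⊆ Finset.range (M + d + 1) := by
    intro n hn
    rw [Finsupp.mem_support_iff, coeff_orbitPolynomial] at hn
    rw [Finset.mem_range]
    by_contra hc
    exact hn (if_neg hc)
  have key := sum_norm_sq_coeff_smul_le h (orbitPolynomial T D x (M + d))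
    (s := Finset.range (M + d + d + 1)) (ha.trans (Finset.range_mono (by omega)))
    (support_smul_orbitPolynomial f T D x hf) (support_smul_orbitPolynomial v T D x hv)
  have h1 : ∑ n ∈ Finset.range (M + d + d + 1), ‖(orbitPolynomial T D x (M + d)).coeff n‖ ^ 2
      = ∑ k ∈ Finset.range (M + d + 1), ‖D ((T ^ k) x)‖ ^ 2 := by
    rw [← Finset.sum_subset (Finset.range_mono (show M + d + 1 ≤ M + d + d + 1 by omega)),
      ← Finset.sum_range_reflect]
    · refine Finset.sum_congr rfl fun k hk => ?_
      rw [Finset.mem_range] at hk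
      rw [coeff_orbitPolynomial, if_pos (by omega)]
      congr 5; omega
    · intro n _ hn
      rw [Finset.mem_range] at hn
      rw [coeff_orbitPolynomial, if_neg hn]; simp
  have main : ∀ g : Polynomial ℂ, g.natDegree ≤ d →
      ∑ m ∈ Finset.range (M + 1), ‖(g • orbitPolynomial T D x (M + d)).coeff (M + d - m)‖ ^ 2
        = ∑ m ∈ Finset.range (M + 1), ‖D ((T ^ m) (Polynomial.aeval T g x))‖ ^ 2 := by
    intro g hg
    refine Finset.sum_congr rfl fun m hm => ?_
    rw [Finset.mem_range] at hm
    rw [coeff_smul_orbitPolynomial g T D x hg (by omega)]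
  have hbd : ∀ n, ‖(v • orbitPolynomial T D x (M + d)).coeff n‖ ^ 2 ≤ B := fun n =>
    pow_le_pow_left₀ (norm_nonneg _) (norm_coeff_smul_orbitPolynomial_le v hT D x hv n) 2
  rw [h1, sum_range_eq_three, sum_range_eq_three, main f hf, main v hv] at key
  have h2 : ∑ n ∈ Finset.range d, ‖(v • orbitPolynomial T D x (M + d)).coeff n‖ ^ 2 ≤ d * B := by
    simpa using Finset.sum_le_sum fun n (_ : n ∈ Finset.range d) => hbd n
  have h3 : ∑ n ∈ Finset.range d, ‖(v • orbitPolynomial T D x (M + d)).coeff (M + d + 1 + n)‖ ^ 2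
      ≤ d * B := by
    simpa using Finset.sum_le_sum fun n (_ : n ∈ Finset.range d) => hbd (M + d + 1 + n)
  have h4 : 0 ≤ ∑ n ∈ Finset.range d, ‖(f • orbitPolynomial T D x (M + d)).coeff n‖ ^ 2 :=
    Finset.sum_nonneg fun _ _ => sq_nonneg _
  have h5 : 0 ≤ ∑ n ∈ Finset.range d,
      ‖(f • orbitPolynomial T D x (M + d)).coeff (M + d + 1 + n)‖ ^ 2 :=
    Finset.sum_nonneg fun _ _ => sq_nonneg _
  have h6 := mul_le_mul_of_nonneg_left (add_le_add h2 h3) hβ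
  nlinarith

end Orbit

/-! ### The asymptotic seminorm and von Neumann's inequality. -/

section VonNeumann

variable {H : Type*} [NormedAddCommGroup H] [InnerProductSpace ℂ H]

/-- The limit of `‖Tⁿ x‖²`, for a contraction `T`. -/
def orbitLimit (T : H →L[ℂ] H) (x : H) : ℝ := ⨅ n : ℕ, ‖(T ^ n) x‖ ^ 2

theorem norm_pow_succ_apply_le {T : H →L[ℂ] H} (hT : ‖T‖ ≤ 1) (n : ℕ) (x : H) :
    ‖(T ^ (n + 1)) x‖ ≤ ‖(T ^ n) x‖ := by
  rw [pow_succ', mul_apply_eq_comp]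
  simpa using T.le_of_opNorm_le hT ((T ^ n) x)

theorem tendsto_orbitLimit {T : H →L[ℂ] H} (hT : ‖T‖ ≤ 1) (x : H) :
    Tendsto (fun n : ℕ => ‖(T ^ n) x‖ ^ 2) atTop (𝓝 (orbitLimit T x)) := by
  refine tendsto_atTop_ciInf (antitone_nat_of_succ_le fun n => ?_)
    ⟨0, by rintro _ ⟨n, rfl⟩; exact sq_nonneg _⟩
  exact pow_le_pow_left₀ (norm_nonneg _) (norm_pow_succ_apply_le hT n x) 2

theorem orbitLimit_le (T : H →L[ℂ] H) (x : H) : orbitLimit T x ≤ ‖x‖ ^ 2 :=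
  (ciInf_le ⟨0, by rintro _ ⟨n, rfl⟩; exact sq_nonneg _⟩ 0).trans (by simp)

/-- The asymptotic seminorm of a contraction obeys the functional calculus of an isometry. -/
theorem orbitLimit_aeval_le {f v : Polynomial ℂ} {α β : ℝ} (hα : 0 ≤ α) (hβ : 0 ≤ β)
    (h : ∀ z : ℂ, ‖z‖ = 1 → ‖f.eval z‖ ^ 2 ≤ α + β * ‖v.eval z‖ ^ 2)
    {T : H →L[ℂ] H} (hT : ‖T‖ ≤ 1) (x : H) :
    orbitLimit T (Polynomial.aeval T f x)
      ≤ α * orbitLimit T x + β * orbitLimit T (Polynomial.aeval T v x) := by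
  set d := max f.natDegree v.natDegree
  obtain ⟨K, hK⟩ := exists_sum_norm_sq_orbit_le hβ h hT (1 : H →L[ℂ] H) x
    (le_max_left _ _ : f.natDegree ≤ d) (le_max_right _ _ : v.natDegree ≤ d)
  simp only [one_apply_eq_self] at hK
  -- With `D = 1`, dividing by `M + 1` turns the orbit sums into Cesàro means, which converge to
  -- `orbitLimit`, while the boundary terms vanish.
  have hces : ∀ y : H, Tendsto (fun M : ℕ => ((M + 1 : ℕ) : ℝ)⁻¹ *
      ∑ m ∈ Finset.range (M + 1), ‖(T ^ m) y‖ ^ 2) atTop (𝓝 (orbitLimit T y)) := fun y =>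
    ((tendsto_orbitLimit hT y).cesaro).comp (tendsto_add_atTop_nat 1)
  have hinv : Tendsto (fun M : ℕ => ((M + 1 : ℕ) : ℝ)⁻¹ * (α * (d * ‖x‖ ^ 2) + β * K)) atTop
      (𝓝 0) := by
    have := (tendsto_inv_atTop_nhds_zero_nat (𝕜 := ℝ)).comp (tendsto_add_atTop_nat 1)
    simpa using this.mul_const (α * (d * ‖x‖ ^ 2) + β * K)
  have hlim := (((hces x).const_mul α).add
    ((hces (Polynomial.aeval T v x)).const_mul β)).add hinv
  rw [add_zero] at hlim
  refine le_of_tendsto_of_tendsto' (hces _) hlim fun M => ?_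
  have h1 : ∑ k ∈ Finset.range (M + d + 1), ‖(T ^ k) x‖ ^ 2
      ≤ ∑ k ∈ Finset.range (M + 1), ‖(T ^ k) x‖ ^ 2 + d * ‖x‖ ^ 2 := by
    rw [show M + d + 1 = M + 1 + d by ring, Finset.sum_range_add]
    gcongr
    simpa using Finset.sum_le_sum fun n (_ : n ∈ Finset.range d) =>
      pow_le_pow_left₀ (norm_nonneg _) (norm_pow_apply_le hT (M + 1 + n) x) 2
  have h2 := (hK M).trans (add_le_add_left (mul_le_mul_of_nonneg_left h1 hα) _)
  have h3 := mul_le_mul_of_nonneg_left h2 (inv_nonneg.2 (Nat.cast_nonneg (α := ℝ) (M + 1)))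
  linarith

/-- The defect operator `(1 - T*T)^(1/2)`; with it the orbit sums telescope. -/
theorem exists_defect [CompleteSpace H] {T : H →L[ℂ] H} (hT : ‖T‖ ≤ 1) :
    ∃ D : H →L[ℂ] H, ∀ y, ‖D y‖ ^ 2 = ‖y‖ ^ 2 - ‖T y‖ ^ 2 := by
  have key : ∀ y, RCLike.re (inner ℂ ((1 - ContinuousLinearMap.adjoint T * T) y) y)
      = ‖y‖ ^ 2 - ‖T y‖ ^ 2 := by
    intro y
    rw [sub_apply, one_apply_eq_self, mul_apply_eq_comp, inner_sub_left, map_sub,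
      ContinuousLinearMap.adjoint_inner_left, inner_self_eq_norm_sq, inner_self_eq_norm_sq]
  have hsa : IsSelfAdjoint (1 - ContinuousLinearMap.adjoint T * T) :=
    (IsSelfAdjoint.one _).sub (IsSelfAdjoint.star_mul_self T)
  have hpos : (0 : H →L[ℂ] H) ≤ 1 - ContinuousLinearMap.adjoint T * T := by
    rw [ContinuousLinearMap.nonneg_iff_isPositive, ContinuousLinearMap.isPositive_def']
    refine ⟨hsa, fun y => ?_⟩
    rw [ContinuousLinearMap.reApplyInnerSelf_apply, key, sub_nonneg]
    exact pow_le_pow_left₀ (norm_nonneg _) (by simpa using T.le_of_opNorm_le hT y) 2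
  refine ⟨CFC.sqrt (1 - ContinuousLinearMap.adjoint T * T), fun y => ?_⟩
  rw [← key, ← CFC.sqrt_mul_sqrt_self (1 - ContinuousLinearMap.adjoint T * T) hpos]
  have hS : IsSelfAdjoint (CFC.sqrt (1 - ContinuousLinearMap.adjoint T * T)) :=
    IsSelfAdjoint.of_nonneg (CFC.sqrt_nonneg _)
  conv_rhs => rw [mul_apply_eq_comp, ← ContinuousLinearMap.adjoint_inner_right,
    ContinuousLinearMap.isSelfAdjoint_iff'.1 hS, inner_self_eq_norm_sq]
  rw [CFC.sqrt_mul_sqrt_self (1 - ContinuousLinearMap.adjoint T * T) hpos]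

/-- The von Neumann inequality for polynomials. -/
theorem norm_aeval_apply_le [CompleteSpace H] {f : Polynomial ℂ} {L : ℝ}
    (h : ∀ z : ℂ, ‖z‖ = 1 → ‖f.eval z‖ ≤ L) {T : H →L[ℂ] H} (hT : ‖T‖ ≤ 1) (x : H) :
    ‖Polynomial.aeval T f x‖ ≤ L * ‖x‖ := by
  have hL : 0 ≤ L := (norm_nonneg _).trans (h 1 norm_one)
  have h' : ∀ z : ℂ, ‖z‖ = 1 →
      ‖f.eval z‖ ^ 2 ≤ L ^ 2 + 0 * ‖(0 : Polynomial ℂ).eval z‖ ^ 2 := fun z hz => by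
    simpa using pow_le_pow_left₀ (norm_nonneg _) (h z hz) 2
  obtain ⟨D, hD⟩ := exists_defect hT
  obtain ⟨K, hK⟩ := exists_sum_norm_sq_orbit_le le_rfl h' hT D x le_rfl
    (by simp : (0 : Polynomial ℂ).natDegree ≤ f.natDegree)
  have tele : ∀ (y : H) (N : ℕ), ∑ m ∈ Finset.range N, ‖D ((T ^ m) y)‖ ^ 2
      = ‖y‖ ^ 2 - ‖(T ^ N) y‖ ^ 2 := by
    intro y N
    have : ∀ m, ‖D ((T ^ m) y)‖ ^ 2 = ‖(T ^ m) y‖ ^ 2 - ‖(T ^ (m + 1)) y‖ ^ 2 := fun m => by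
      rw [hD, pow_succ' T, mul_apply_eq_comp]
    simp_rw [this]
    rw [Finset.sum_range_sub']
    simp
  simp only [tele, zero_mul, add_zero] at hK
  have l1 : Tendsto (fun M : ℕ => ‖Polynomial.aeval T f x‖ ^ 2
      - ‖(T ^ (M + 1)) (Polynomial.aeval T f x)‖ ^ 2) atTop
      (𝓝 (‖Polynomial.aeval T f x‖ ^ 2 - orbitLimit T (Polynomial.aeval T f x))) :=
    ((tendsto_orbitLimit hT _).comp (tendsto_add_atTop_nat 1)).const_sub _
  have l2 : Tendsto (fun M : ℕ => L ^ 2 * (‖x‖ ^ 2 - ‖(T ^ (M + f.natDegree + 1)) x‖ ^ 2)) atTop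
      (𝓝 (L ^ 2 * (‖x‖ ^ 2 - orbitLimit T x))) :=
    (((tendsto_orbitLimit hT _).comp (tendsto_add_atTop_nat (f.natDegree + 1))).const_sub
      _).const_mul _
  -- `h1` controls the part of the norm lost along the orbit, `h2` the part that survives in the
  -- limit; their sum is the inequality.
  have h1 := le_of_tendsto_of_tendsto' l1 l2 hK
  have h2 := orbitLimit_aeval_le (sq_nonneg L) le_rfl h' hT x
  refine le_of_sq_le_sq ?_ (by positivity)
  rw [mul_pow]
  linarith

end VonNeumann

/-! ### Polynomials imitating the conjugate coordinate where a given polynomial is small. -/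

section PeakPolynomials

open Polynomial

theorem norm_eval_zero_le_of_circle {g : ℂ → ℂ} (hg : Differentiable ℂ g) {B : ℝ}
    (h : ∀ z : ℂ, ‖z‖ = 1 → ‖g z‖ ≤ B) : ‖g 0‖ ≤ B := by
  refine Complex.norm_le_of_forall_mem_frontier_norm_le (U := Metric.ball (0 : ℂ) 1)
    Metric.isBounded_ball hg.diffContOnCl (fun z hz => h z ?_)
    (subset_closure (Metric.mem_ball_self one_pos))
  rw [frontier_ball _ one_ne_zero] at hz
  simpa using hz

theorem exists_fourier_one_eq {z : ℂ} (hz : ‖z‖ = 1) :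
    ∃ t : UnitAddCircle, (fourier 1 t : ℂ) = z := by
  obtain ⟨t, ht⟩ := (AddCircle.homeomorphCircle (T := 1) one_ne_zero).surjective
    ⟨z, by simpa [Submonoid.unitSphere] using hz⟩
  refine ⟨t, ?_⟩
  rw [fourier_apply, one_zsmul, ← AddCircle.homeomorphCircle_apply one_ne_zero, ht]

theorem exists_polynomial_add_conj_eq {f : C(UnitAddCircle, ℂ)}
    (hf : f ∈ Submodule.span ℂ (Set.range (@fourier (1 : ℝ)))) :
    ∃ p q : ℂ[X], ∀ t, f t = p.eval (fourier 1 t : ℂ)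
      + (starRingEnd ℂ) (q.eval (fourier 1 t : ℂ)) := by
  have hpow : ∀ (n : ℕ) (t : UnitAddCircle), (fourier 1 t : ℂ) ^ n = fourier (n : ℤ) t := by
    intro n t
    induction n with
    | zero => simp
    | succ k ih => rw [pow_succ, ih, Nat.cast_succ, fourier_add]
  induction hf using Submodule.span_induction with
  | mem x hx =>
    obtain ⟨n, rfl⟩ := hx
    obtain ⟨k, rfl | rfl⟩ := n.eq_nat_or_neg
    · exact ⟨X ^ k, 0, fun t => by simp only [eval_pow, eval_X, hpow,
        eval_zero, map_zero, add_zero]⟩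
    · exact ⟨0, X ^ k, fun t => by simp only [eval_zero, zero_add, eval_pow, eval_X, hpow,
        fourier_neg]⟩
  | zero => exact ⟨0, 0, fun t => by simp⟩
  | add x y _ _ hx hy =>
    obtain ⟨p, q, h⟩ := hx
    obtain ⟨p', q', h'⟩ := hy
    refine ⟨p + p', q + q', fun t => ?_⟩
    rw [ContinuousMap.add_apply, h, h', eval_add, eval_add, map_add]
    ring
  | smul a x _ hx =>
    obtain ⟨p, q, h⟩ := hx
    refine ⟨C a * p, C ((starRingEnd ℂ) a) * q, fun t => ?_⟩
    rw [ContinuousMap.smul_apply, h, eval_mul, eval_mul, eval_C, eval_C, map_mul,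
      Complex.conj_conj, smul_eq_mul]
    ring

/-- Real parts of polynomials are uniformly dense in the continuous real functions on the circle. -/
theorem exists_polynomial_re_near {h : ℂ → ℝ} (hh : Continuous h) {ε : ℝ} (hε : 0 < ε) :
    ∃ p : ℂ[X], (p.eval 0).im = 0 ∧ ∀ z : ℂ, ‖z‖ = 1 → |(p.eval z).re - h z| ≤ ε := by
  let f : C(UnitAddCircle, ℂ) :=
    ⟨fun t => (h (fourier 1 t : ℂ) : ℂ), by fun_prop⟩
  have hf : f ∈ (Submodule.span ℂ (Set.range (@fourier (1 : ℝ)))).topologicalClosure := by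
    rw [span_fourier_closure_eq_top]; trivial
  obtain ⟨g, hg, hfg⟩ := Metric.mem_closure_iff.1 hf ε hε
  obtain ⟨p, q, hpq⟩ := exists_polynomial_add_conj_eq hg
  -- On the circle `p + conj q` and `p + q` have the same real part; removing an imaginary constant
  -- makes the value at 0 real.
  refine ⟨p + q - C (Complex.I * ((p + q).eval 0).im), ?_, fun z hz => ?_⟩
  · simp
  · obtain ⟨t, rfl⟩ := exists_fourier_one_eq hz
    have h1 : ‖f t - g t‖ ≤ ε := by
      rw [← dist_eq_norm]; exact (ContinuousMap.dist_apply_le_dist t).trans hfg.le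
    have h2 := (Complex.abs_re_le_norm _).trans h1
    rw [hpq, Complex.sub_re, abs_sub_comm] at h2
    simpa [f] using h2

/-- Approximate inverses of polynomials with positive real part on the circle. -/
theorem exists_polynomial_mul_near_one {F : ℂ[X]} {κ : ℝ} (hκ : 0 < κ)
    (hF : ∀ z : ℂ, ‖z‖ = 1 → κ ≤ (F.eval z).re) {ε : ℝ} (hε : 0 < ε) :
    ∃ G : ℂ[X], ∀ z : ℂ, ‖z‖ = 1 → ‖(F * G).eval z - 1‖ ≤ ε := by
  obtain ⟨B, hB⟩ := (isCompact_sphere (0 : ℂ) 1).exists_bound_of_continuousOn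
    (f := fun z => F.eval z) F.continuous.continuousOn
  replace hB : ∀ z : ℂ, ‖z‖ = 1 → ‖F.eval z‖ ≤ B := fun z hz => hB z (by simpa using hz)
  have hκB : κ ≤ B := (hF 1 norm_one).trans ((Complex.re_le_norm _).trans (hB 1 norm_one))
  have hB0 : 0 < B := hκ.trans_le hκB
  -- This `a` minimises the bound `1 - 2aκ + a²B²` for `|1 - aF|²`, with minimum `ρ²`. As `ρ < 1`, a
  -- truncated Neumann series inverts `F` approximately.
  set a : ℝ := κ / B ^ 2
  set ρ : ℝ := Real.sqrt (1 - κ ^ 2 / B ^ 2)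
  have hρ0 : 0 ≤ 1 - κ ^ 2 / B ^ 2 := by
    rw [sub_nonneg, div_le_one (by positivity)]
    exact pow_le_pow_left₀ hκ.le hκB 2
  have hρ1 : ρ < 1 := by
    rw [Real.sqrt_lt' one_pos]
    have : 0 < κ ^ 2 / B ^ 2 := by positivity
    linarith
  have hcontr : ∀ z : ℂ, ‖z‖ = 1 → ‖(1 - C (a : ℂ) * F).eval z‖ ≤ ρ := by
    intro z hz
    refine Real.le_sqrt_of_sq_le ?_
    have e1 : ‖(1 - C (a : ℂ) * F).eval z‖ ^ 2
        = 1 - 2 * a * (F.eval z).re + a ^ 2 * ‖F.eval z‖ ^ 2 := by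
      rw [← Complex.normSq_eq_norm_sq, ← Complex.normSq_eq_norm_sq, Complex.normSq_apply,
        Complex.normSq_apply]
      simp
      ring
    have e2 : a * κ ≤ a * (F.eval z).re :=
      mul_le_mul_of_nonneg_left (hF z hz) (by positivity)
    have e3 : a ^ 2 * ‖F.eval z‖ ^ 2 ≤ a ^ 2 * B ^ 2 :=
      mul_le_mul_of_nonneg_left (pow_le_pow_left₀ (norm_nonneg _) (hB z hz) 2) (sq_nonneg _)
    have e4 : a * κ = κ ^ 2 / B ^ 2 := by simp only [a]; ring
    have e5 : a ^ 2 * B ^ 2 = κ ^ 2 / B ^ 2 := by simp only [a]; field_simp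
    rw [e1]
    linarith
  obtain ⟨N, hN⟩ := exists_pow_lt_of_lt_one hε hρ1
  refine ⟨C (a : ℂ) * ∑ n ∈ Finset.range N, (1 - C (a : ℂ) * F) ^ n, fun z hz => ?_⟩
  have : F * (C (a : ℂ) * ∑ n ∈ Finset.range N, (1 - C (a : ℂ) * F) ^ n)
      = 1 - (1 - C (a : ℂ) * F) ^ N := by
    rw [← mul_neg_geom_sum]
    ring
  rw [this, eval_sub, eval_one, eval_pow, sub_sub_cancel_left, norm_neg, norm_pow]
  exact (pow_le_pow_left₀ (norm_nonneg _) (hcontr z hz) N).trans hN.le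

theorem norm_sub_ofReal_le_norm_add_ofReal {w : ℂ} {c : ℝ} (hw : 0 ≤ w.re) (hc : 0 ≤ c) :
    ‖w - c‖ ≤ ‖w + c‖ := by
  refine le_of_sq_le_sq ?_ (norm_nonneg _)
  rw [← Complex.normSq_eq_norm_sq, ← Complex.normSq_eq_norm_sq, Complex.normSq_apply,
    Complex.normSq_apply]
  simp
  nlinarith [mul_nonneg hw hc]

/-- A polynomial whose real part is large where `v` is small, while its value at the origin is
bounded in terms of `v 0`. -/
theorem exists_polynomial_re_large {v : ℂ[X]} {η s : ℝ} (hη : 0 < η) (hs : 0 < s) (hs1 : s ≤ 1)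
    (hv : ∀ z : ℂ, ‖z‖ = 1 → ‖v.eval z‖ ≤ 1) (hv0 : η ≤ ‖v.eval 0‖) :
    ∃ (F : ℂ[X]) (c : ℝ), F.eval 0 = c ∧ 0 < c ∧ c ≤ 2 + |Real.log η| ∧
      (∀ z : ℂ, ‖z‖ = 1 → 0 ≤ (F.eval z).re) ∧
      ∀ z : ℂ, ‖z‖ = 1 → ‖v.eval z‖ ≤ s → - Real.log s ≤ (F.eval z).re := by
  -- `F = p + 1` with `Re p` within 1/2 of `-(log k)/2`, roughly `-log |v|` cut off at level `s`.
  -- The term `s ^ 2` keeps the logarithm continuous at the zeros of `v`.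
  set k : ℂ → ℝ := fun z => (‖v.eval z‖ ^ 2 + s ^ 2) / 2
  have hk : ∀ z, 0 < k z := fun z => by simp only [k]; positivity
  have hcont : Continuous k := by
    have := v.continuous
    fun_prop
  obtain ⟨p, hp0, hp⟩ := exists_polynomial_re_near (h := fun z => -(Real.log (k z) / 2))
    ((hcont.log fun z => (hk z).ne').div_const 2).neg (ε := 1 / 2) (by norm_num)
  have hk1 : ∀ z : ℂ, ‖z‖ = 1 → Real.log (k z) ≤ 0 := by
    intro z hz
    refine Real.log_nonpos (hk z).le ?_
    have := pow_le_pow_left₀ (norm_nonneg _) (hv z hz) 2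
    have := pow_le_pow_left₀ hs.le hs1 2
    simp only [k]
    linarith
  have hF : ∀ z : ℂ, ‖z‖ = 1 → 1 / 2 - Real.log (k z) / 2 ≤ ((p + 1).eval z).re := by
    intro z hz
    have := (abs_le.1 (hp z hz)).1
    simp only [eval_add, eval_one, Complex.add_re, Complex.one_re]
    linarith
  have hF0 : (p + 1).eval 0 = (((p.eval 0).re + 1 : ℝ) : ℂ) := by
    apply Complex.ext <;> simp [hp0]
  refine ⟨p + 1, (p.eval 0).re + 1, hF0, ?_, ?_, ?_, ?_⟩
  -- The maximum principle for `exp(-F)` gives `c ≥ 1/2`.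
  · have := norm_eval_zero_le_of_circle (g := fun z => Complex.exp (-((p + 1).eval z)))
      (B := Real.exp (-(1 / 2))) ((p + 1).differentiable.neg.cexp) fun z hz => by
        rw [Complex.norm_exp, Complex.neg_re, Real.exp_le_exp]
        linarith [hF z hz, hk1 z hz]
    rw [Complex.norm_exp, hF0, Complex.neg_re, Real.exp_le_exp, Complex.ofReal_re] at this
    linarith
  -- A Jensen-type estimate: `|v e^p| ≤ e` on the circle because `k ≥ |v|²/2`. The resulting bound
  -- on `c` depends on `η` but not on `s`.
  · have := norm_eval_zero_le_of_circle (g := fun z => v.eval z * Complex.exp (p.eval z))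
      (B := Real.exp 1) (v.differentiable.mul p.differentiable.cexp) fun z hz => by
        rw [norm_mul, Complex.norm_exp]
        rcases eq_or_ne (v.eval z) 0 with h0 | h0
        · rw [h0, norm_zero, zero_mul]; positivity
        have hpos : 0 < ‖v.eval z‖ := norm_pos_iff.2 h0
        rw [← Real.exp_log hpos, ← Real.exp_add, Real.exp_le_exp]
        have h1 := (abs_le.1 (hp z hz)).2
        have h2 : Real.log (‖v.eval z‖ ^ 2 / 2) ≤ Real.log (k z) :=
          Real.log_le_log (by positivity) (by simp only [k]; linarith [sq_nonneg s])
        rw [Real.log_div (by positivity) two_ne_zero, Real.log_pow] at h2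
        push_cast at h2
        have h3 : Real.log 2 ≤ 1 := by linarith [Real.log_two_lt_d9]
        linarith
    rw [norm_mul, Complex.norm_exp] at this
    have h1 : Real.exp (Real.log η + (p.eval 0).re) ≤ Real.exp 1 := by
      rw [Real.exp_add, Real.exp_log hη]
      exact (mul_le_mul_of_nonneg_right hv0 (Real.exp_pos _).le).trans this
    rw [Real.exp_le_exp] at h1
    linarith [neg_abs_le (Real.log η)]
  · intro z hz
    linarith [hF z hz, hk1 z hz]
  · intro z hz hzs
    have h1 : Real.log (k z) ≤ Real.log (s ^ 2) := by
      refine Real.log_le_log (hk z) ?_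
      have := pow_le_pow_left₀ (norm_nonneg _) hzs 2
      simp only [k]
      linarith
    rw [Real.log_pow] at h1
    push_cast at h1
    linarith [hF z hz]

/-- If `v` is bounded by one on the circle and `v 0` is not small, then there is a polynomial of norm
almost one that approximates the conjugate coordinate wherever `v` is small on the circle. -/
theorem exists_polynomial_near_conj {η ε : ℝ} (hη : 0 < η) (hε : 0 < ε) :
    ∃ M : ℝ, 0 ≤ M ∧ ∀ v : ℂ[X], (∀ z : ℂ, ‖z‖ = 1 → ‖v.eval z‖ ≤ 1) → η ≤ ‖v.eval 0‖ →
      ∃ q : ℂ[X], (∀ z : ℂ, ‖z‖ = 1 → ‖q.eval z‖ ≤ 1 + ε) ∧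
        ∀ z : ℂ, ‖z‖ = 1 → ‖(X * q - 1).eval z‖ ≤ ε + M * ‖v.eval z‖ := by
  set C₀ : ℝ := 2 + |Real.log η|
  have hC₀ : 0 < C₀ := by positivity
  -- Chosen so that `-log s = 4C₀/ε`: where `|v| ≤ s` this makes `2c/|F + c| ≤ ε/2`. Elsewhere the
  -- trivial bound 2 is at most `(2/s)|v|`.
  set s : ℝ := Real.exp (-(4 * C₀ / ε))
  have hs : 0 < s := Real.exp_pos _
  have hs1 : s ≤ 1 := Real.exp_le_one_iff.2 (by rw [neg_nonpos]; positivity)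
  refine ⟨2 / s, by positivity, fun v hv hv0 => ?_⟩
  obtain ⟨F, c, hF0, hc, hcC, hFre, hFs⟩ := exists_polynomial_re_large hη hs hs1 hv hv0
  have hFc : ∀ z : ℂ, ‖z‖ = 1 → (F.eval z).re + c ≤ ‖F.eval z + c‖ := fun z _ => by
    simpa using Complex.re_le_norm (F.eval z + c)
  obtain ⟨G, hG⟩ := exists_polynomial_mul_near_one (F := F + C (c : ℂ)) hc
    (fun z hz => by simpa using hFre z hz) (ε := ε / 6) (by positivity)
  have hG0 := norm_eval_zero_le_of_circle
    (g := fun z => ((F + C (c : ℂ)) * G).eval z - 1) (by fun_prop) hG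
  -- With `G` close to `1/(F + c)`, `P` is close to the Cayley transform `(F - c)/(F + c)`, which
  -- has modulus at most 1, vanishes at 0 since `F(0) = c`, and is near 1 where `Re F` is large. The
  -- required `q` is `(P - P(0))/z`.
  set P : ℂ[X] := 1 - C (2 * c : ℂ) * G
  have hP0 : ‖P.eval 0‖ ≤ ε / 6 := by
    have : -(P.eval 0) = ((F + C (c : ℂ)) * G).eval 0 - 1 := by
      simp only [P, eval_sub, eval_one, eval_mul, eval_add, eval_C, hF0]
      ring
    rw [← norm_neg, this]
    exact hG0
  have hdiff : ∀ z : ℂ, ‖z‖ = 1 →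
      ‖(2 * c : ℂ) * G.eval z - 2 * c / (F.eval z + c)‖ ≤ ε / 3 := by
    intro z hz
    have hne : 0 < ‖F.eval z + c‖ := by linarith [hFc z hz, hFre z hz]
    have hne' := norm_pos_iff.1 hne
    have : (2 * c : ℂ) * G.eval z - 2 * c / (F.eval z + c)
        = 2 * c * (((F + C (c : ℂ)) * G).eval z - 1) / (F.eval z + c) := by
      simp only [eval_mul, eval_add, eval_C]
      field_simp
    rw [this, norm_div, norm_mul, norm_mul, div_le_iff₀ hne, Complex.norm_real, Complex.norm_ofNat,
      Real.norm_of_nonneg hc.le]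
    have h1 := mul_le_mul_of_nonneg_left (hG z hz) (by positivity : 0 ≤ 2 * c)
    have h2 : ε / 3 * c ≤ ε / 3 * ‖F.eval z + c‖ :=
      mul_le_mul_of_nonneg_left (by linarith [hFc z hz, hFre z hz]) (by positivity)
    linarith
  have hXq : ∀ z : ℂ, z * P.divX.eval z = P.eval z - P.eval 0 := by
    intro z
    have h1 := congrArg (eval z) P.divX_mul_X_add
    have h2 := congrArg (eval 0) P.divX_mul_X_add
    simp only [eval_add, eval_mul, eval_X, eval_C, mul_zero, zero_add] at h1 h2
    rw [← h1, ← h2]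
    ring
  refine ⟨P.divX, fun z hz => ?_, fun z hz => ?_⟩
  · rw [← one_mul ‖P.divX.eval z‖, ← hz, ← norm_mul, hXq, hz]
    have hne : 0 < ‖F.eval z + c‖ := by linarith [hFc z hz, hFre z hz]
    have hne' := norm_pos_iff.1 hne
    have h1 : ‖(F.eval z - c) / (F.eval z + c)‖ ≤ 1 := by
      rw [norm_div, div_le_one hne]
      exact norm_sub_ofReal_le_norm_add_ofReal (hFre z hz) hc.le
    have h2 : P.eval z - P.eval 0 = (F.eval z - c) / (F.eval z + c)
        - ((2 * c : ℂ) * G.eval z - 2 * c / (F.eval z + c)) - P.eval 0 := by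
      simp only [P, eval_sub, eval_one, eval_mul, eval_C]
      field_simp
      ring
    rw [h2]
    refine (norm_sub_le _ _).trans ?_
    have := norm_sub_le ((F.eval z - c) / (F.eval z + c))
      ((2 * c : ℂ) * G.eval z - 2 * c / (F.eval z + c))
    linarith [hdiff z hz]
  · have hne : 0 < ‖F.eval z + c‖ := by linarith [hFc z hz, hFre z hz]
    have h2 : (X * P.divX - 1).eval z = - (((2 * c : ℂ) * G.eval z - 2 * c / (F.eval z + c))
        + 2 * c / (F.eval z + c) + P.eval 0) := by
      rw [eval_sub, eval_mul, eval_X, hXq]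
      simp only [P, eval_sub, eval_one, eval_mul, eval_C]
      ring
    have h3 : ‖(2 * c : ℂ) / (F.eval z + c)‖ ≤ ε / 2 + 2 / s * ‖v.eval z‖ := by
      rw [norm_div, norm_mul, Complex.norm_real, Complex.norm_ofNat, Real.norm_of_nonneg hc.le]
      rcases le_or_gt ‖v.eval z‖ s with h | h
      · have h4 := hFs z hz h
        rw [Real.log_exp, neg_neg] at h4
        have h5 : ε / 2 * (4 * C₀ / ε) = 2 * C₀ := by field_simp; ring
        have h6 : 2 * c / ‖F.eval z + c‖ ≤ ε / 2 := by
          rw [div_le_iff₀ hne]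
          have := mul_le_mul_of_nonneg_left
            (show 4 * C₀ / ε ≤ ‖F.eval z + c‖ by linarith [hFc z hz])
            (by positivity : 0 ≤ ε / 2)
          linarith
        have : 0 ≤ 2 / s * ‖v.eval z‖ := by positivity
        linarith
      · have h6 : 2 * c / ‖F.eval z + c‖ ≤ 2 := by
          rw [div_le_iff₀ hne]
          linarith [hFc z hz, hFre z hz]
        have h7 : 2 ≤ 2 / s * ‖v.eval z‖ := by
          rw [div_mul_eq_mul_div, le_div_iff₀ hs]
          linarith
        linarith
    rw [h2, norm_neg]
    refine (norm_add_le _ _).trans ?_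
    have := norm_add_le ((2 * c : ℂ) * G.eval z - 2 * c / (F.eval z + c))
      (2 * c / (F.eval z + c))
    linarith [hdiff z hz]

end PeakPolynomials

/-! ### The strong limit of `T*ⁿ Tⁿ` and complete non-unitarity. -/

section AsymptoticLimit

variable {H : Type*} [NormedAddCommGroup H] [InnerProductSpace ℂ H] [CompleteSpace H]

theorem adjoint_apply_norm_le {R : H →L[ℂ] H} (hR : ‖R‖ ≤ 1) (y : H) :
    ‖ContinuousLinearMap.adjoint R y‖ ≤ ‖y‖ := by
  have h : ‖ContinuousLinearMap.adjoint R‖ ≤ 1 := by rwa [LinearIsometryEquiv.norm_map]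
  simpa using ContinuousLinearMap.le_of_opNorm_le _ h y

/-- Quantitative form of the fact that a contraction preserving `‖y‖` satisfies `R*R y = y`. It
makes `T*ⁿ Tⁿ x` a Cauchy sequence and later settles the equality case giving `T A = A T`. -/
theorem norm_sub_adjoint_mul_self_apply_sq_le {R : H →L[ℂ] H} (hR : ‖R‖ ≤ 1) (y : H) :
    ‖y - ContinuousLinearMap.adjoint R (R y)‖ ^ 2 ≤ ‖y‖ ^ 2 - ‖R y‖ ^ 2 := by
  rw [norm_sub_sq (𝕜 := ℂ), ContinuousLinearMap.adjoint_inner_right, inner_self_eq_norm_sq]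
  have := pow_le_pow_left₀ (norm_nonneg _) (adjoint_apply_norm_le hR (R y)) 2
  linarith

omit [CompleteSpace H] in
theorem norm_pow_le_one {T : H →L[ℂ] H} (hT : ‖T‖ ≤ 1) (n : ℕ) : ‖T ^ n‖ ≤ 1 :=
  ContinuousLinearMap.opNorm_le_bound _ zero_le_one fun x => by
    simpa using norm_pow_apply_le hT n x

theorem norm_sub_adjoint_pow_mul_pow_sq_le {T : H →L[ℂ] H} (hT : ‖T‖ ≤ 1) (x : H) {m n : ℕ}
    (hmn : m ≤ n) :
    ‖ContinuousLinearMap.adjoint (T ^ m) ((T ^ m) x)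
        - ContinuousLinearMap.adjoint (T ^ n) ((T ^ n) x)‖ ^ 2
      ≤ ‖(T ^ m) x‖ ^ 2 - ‖(T ^ n) x‖ ^ 2 := by
  obtain ⟨k, rfl⟩ := Nat.exists_eq_add_of_le hmn
  have h1 : T ^ (m + k) = (T ^ k).comp (T ^ m) := by rw [add_comm, pow_add]; rfl
  rw [h1, ContinuousLinearMap.adjoint_comp, ContinuousLinearMap.comp_apply,
    ContinuousLinearMap.comp_apply, ← map_sub]
  refine le_trans (pow_le_pow_left₀ (norm_nonneg _)
    (adjoint_apply_norm_le (norm_pow_le_one hT m) _) 2) ?_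
  exact norm_sub_adjoint_mul_self_apply_sq_le (norm_pow_le_one hT k) _

/-- The asymptotic limit of a contraction: the strong limit of `T*ⁿ Tⁿ`. -/
theorem exists_asymptoticLimit {T : H →L[ℂ] H} (hT : ‖T‖ ≤ 1) :
    ∃ A : H →L[ℂ] H, ∀ x, Tendsto (fun n : ℕ => ContinuousLinearMap.adjoint (T ^ n) ((T ^ n) x))
      atTop (𝓝 (A x)) := by
  have hc : ∀ x, CauchySeq (fun n : ℕ => ContinuousLinearMap.adjoint (T ^ n) ((T ^ n) x)) := by
    intro x
    have hx := (tendsto_orbitLimit hT x).cauchySeq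
    rw [Metric.cauchySeq_iff'] at hx ⊢
    intro ε hε
    obtain ⟨N, hN⟩ := hx (ε ^ 2) (by positivity)
    refine ⟨N, fun n hn => ?_⟩
    rw [dist_comm, dist_eq_norm]
    have h1 := hN n hn
    rw [dist_comm, Real.dist_eq] at h1
    exact lt_of_pow_lt_pow_left₀ 2 hε.le
      ((norm_sub_adjoint_pow_mul_pow_sq_le hT x hn).trans_lt ((le_abs_self _).trans_lt h1))
  choose A hA using fun x => cauchySeq_tendsto_of_complete (hc x)
  let S : ℕ → H →L[ℂ] H := fun n => (ContinuousLinearMap.adjoint (T ^ n)).comp (T ^ n)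
  have hS : Tendsto (fun n x => S n x) atTop (𝓝 A) := tendsto_pi_nhds.2 hA
  exact ⟨continuousLinearMapOfTendsto S hS, hA⟩

theorem norm_sq_asymptoticLimit_le {T A : H →L[ℂ] H} (hT : ‖T‖ ≤ 1)
    (hA : ∀ x, Tendsto (fun n : ℕ => ContinuousLinearMap.adjoint (T ^ n) ((T ^ n) x))
      atTop (𝓝 (A x))) (x : H) : ‖A x‖ ^ 2 ≤ orbitLimit T x :=
  le_of_tendsto_of_tendsto' ((hA x).norm.pow 2) (tendsto_orbitLimit hT x) fun n =>
    pow_le_pow_left₀ (norm_nonneg _) (adjoint_apply_norm_le (norm_pow_le_one hT n) _) 2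

/-- If the range of `A T` is approximated by `A` with control of norms, where `A` is the asymptotic
limit of the completely non-unitary contraction `T`, then the powers of `T` tend to zero. -/
theorem orbitLimit_eq_zero_of_approx {T A : H →L[ℂ] H} (hT : ‖T‖ ≤ 1)
    (hcnu : IsCompletelyNonUnitary T)
    (hA : ∀ x, Tendsto (fun n : ℕ => ContinuousLinearMap.adjoint (T ^ n) ((T ^ n) x))
      atTop (𝓝 (A x)))
    (happ : ∀ (y : H) (ε : ℝ), 0 < ε → ∃ z, ‖z‖ ≤ (1 + ε) * ‖y‖ ∧ ‖A (T z) - A y‖ ≤ ε) (x : H) :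
    orbitLimit T x = 0 := by
  set Ts := ContinuousLinearMap.adjoint T
  have hinner : ∀ x y, inner ℂ (A x) y = inner ℂ x (A y) := by
    intro x y
    refine tendsto_nhds_unique ((hA x).inner tendsto_const_nhds) ?_
    refine (tendsto_const_nhds.inner (hA y)).congr fun n => ?_
    rw [ContinuousLinearMap.adjoint_inner_left, ContinuousLinearMap.adjoint_inner_right]
  have hTAT : ∀ x, Ts (A (T x)) = A x := by
    intro x
    refine tendsto_nhds_unique ((Ts.continuous.tendsto _).comp (hA (T x))) ?_
    refine ((hA x).comp (tendsto_add_atTop_nat 1)).congr fun n => ?_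
    have h1 : T ^ (n + 1) = (T ^ n).comp T := pow_succ T n
    simp only [Function.comp_apply]
    rw [h1, ContinuousLinearMap.adjoint_comp]
    rfl
  -- Approximate `A(A T x)` by `A T z`, with `‖z‖` almost at most `‖A T x‖`. Then `‖A T x‖² = ⟨T x,
  -- A(A T x)⟩ ≈ ⟨T x, A T z⟩ = ⟨T*A T x, z⟩ = ⟨A x, z⟩`.
  have hle : ∀ x, ‖A (T x)‖ ≤ ‖A x‖ := by
    intro x
    have hε : ∀ ε : ℝ, 0 < ε →
        ‖A (T x)‖ ^ 2 ≤ ‖A x‖ * ((1 + ε) * ‖A (T x)‖) + ‖x‖ * ε := by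
      intro ε hε
      obtain ⟨z, hz, hAz⟩ := happ (A (T x)) ε hε
      have e : (inner ℂ (A (T x)) (A (T x)) : ℂ)
          = inner ℂ (A x) z - inner ℂ (T x) (A (T z) - A (A (T x))) := by
        rw [inner_sub_right, ← hinner (T x) (T z), ← hinner (T x) (A (T x)), ← hTAT x,
          ContinuousLinearMap.adjoint_inner_left]
        ring
      have e2 : ‖A (T x)‖ ^ 2 = ‖(inner ℂ (A (T x)) (A (T x)) : ℂ)‖ := by
        rw [inner_self_eq_norm_sq_to_K]; simp
      rw [e2, e]
      refine (norm_sub_le _ _).trans (add_le_add ?_ ?_)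
      · exact (norm_inner_le_norm _ _).trans (mul_le_mul_of_nonneg_left hz (norm_nonneg _))
      · refine (norm_inner_le_norm _ _).trans ?_
        exact mul_le_mul (by simpa using T.le_of_opNorm_le hT x) hAz (norm_nonneg _) (norm_nonneg _)
    have hlim : Tendsto (fun ε : ℝ => ‖A x‖ * ((1 + ε) * ‖A (T x)‖) + ‖x‖ * ε) (𝓝[>] 0)
        (𝓝 (‖A x‖ * ((1 + 0) * ‖A (T x)‖) + ‖x‖ * 0)) :=
      (Continuous.tendsto (by fun_prop) 0).mono_left nhdsWithin_le_nhds
    have h1 := ge_of_tendsto hlim (eventually_mem_nhdsWithin.mono fun ε h => hε ε h)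
    rcases (norm_nonneg (A (T x))).eq_or_lt with h0 | h0
    · rw [← h0]; exact norm_nonneg _
    · refine le_of_mul_le_mul_right ?_ h0
      linarith
  -- Since `T*` maps `A T x` to `A x` without loss of norm, `T T*` fixes `A T x`.
  have hTT : ∀ x, T (A x) = A (T x) := by
    intro x
    have hn : ‖A x‖ = ‖A (T x)‖ :=
      le_antisymm ((congrArg norm (hTAT x)).symm.trans_le (adjoint_apply_norm_le hT _)) (hle x)
    have h1 := norm_sub_adjoint_mul_self_apply_sq_le (R := Ts)
      (by rwa [LinearIsometryEquiv.norm_map]) (A (T x))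
    rw [hTAT, ContinuousLinearMap.adjoint_adjoint, hn, sub_self] at h1
    have h2 : ‖A (T x) - T (A x)‖ = 0 := by
      nlinarith [norm_nonneg (A (T x) - T (A x))]
    exact (sub_eq_zero.1 (norm_eq_zero.1 h2)).symm
  have hTsA : ∀ x, Ts (A x) = A (Ts x) := by
    intro x
    refine ext_inner_right ℂ fun y => ?_
    rw [ContinuousLinearMap.adjoint_inner_left, hinner, ← hTT, hinner,
      ContinuousLinearMap.adjoint_inner_left]
  -- `M` reduces `T`, and `T` is unitary on it, so it is zero; then `A = 0`, and `lim ‖Tⁿ x‖² = ⟨A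
  -- x, x⟩ = 0`.
  set M : Submodule ℂ H := (LinearMap.range (A : H →ₗ[ℂ] H)).topologicalClosure
  have hmem : ∀ x, A x ∈ M := fun x => subset_closure ⟨x, rfl⟩
  have hind : ∀ p : H → Prop, IsClosed {y | p y} → (∀ x, p (A x)) → ∀ y ∈ M, p y := by
    intro p hp h y hy
    exact closure_minimal (t := {y | p y}) (by rintro _ ⟨x, rfl⟩; exact h x) hp hy
  have hMc : IsClosed (M : Set H) := Submodule.isClosed_topologicalClosure _
  have hbot := hcnu M hMc
    (hind _ (hMc.preimage T.continuous) fun x => by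
      rw [hTT]; exact hmem _)
    (hind _ (hMc.preimage Ts.continuous) fun x => by
      change Ts (A x) ∈ M
      rw [hTsA]; exact hmem _)
    (hind _ ?_ fun x => ⟨?_, ?_⟩)
  · have hA0 : A x = 0 := by
      have := hmem x
      rwa [hbot, Submodule.mem_bot] at this
    have h1 : Tendsto (fun n : ℕ => ‖(T ^ n) x‖ ^ 2) atTop
        (𝓝 (RCLike.re (inner ℂ (A x) x : ℂ))) := by
      refine ((RCLike.continuous_re.tendsto _).comp ((hA x).inner tendsto_const_nhds)).congr
        fun n => ?_
      simp only [Function.comp_apply]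
      rw [ContinuousLinearMap.adjoint_inner_left, inner_self_eq_norm_sq]
    rw [tendsto_nhds_unique (tendsto_orbitLimit hT x) h1, hA0, inner_zero_left, map_zero]
  · exact (isClosed_eq (by fun_prop) continuous_id).inter (isClosed_eq (by fun_prop) continuous_id)
  · change Ts (T (A x)) = A x
    rw [hTT, hTAT]
  · change T (Ts (A x)) = A x
    refine sub_eq_zero.1 (norm_eq_zero.1 (le_antisymm (le_of_forall_pos_le_add fun ε hε => ?_)
      (norm_nonneg _)))
    obtain ⟨z, -, hz⟩ := happ x (ε / 2) (by positivity)
    -- `T T*` fixes every `A T z`, and `A T z` approximates `A x`.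
    have e : T (Ts (A x)) - A x = (A (T z) - A x) - T (Ts (A (T z) - A x)) := by
      rw [map_sub, hTAT, map_sub, hTT z]; abel
    have h2 : ‖T (Ts (A (T z) - A x))‖ ≤ ‖A (T z) - A x‖ :=
      (by simpa using T.le_of_opNorm_le hT (Ts (A (T z) - A x)) :
        _ ≤ ‖Ts (A (T z) - A x)‖).trans (adjoint_apply_norm_le hT _)
    rw [e, zero_add]
    linarith [norm_sub_le (A (T z) - A x) (T (Ts (A (T z) - A x)))]

/-- A completely non-unitary contraction `T` has powers tending strongly to zero if every vector is
almost annihilated, asymptotically, by polynomials of `T` bounded by one on the circle and bounded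
away from zero at the origin. -/
theorem orbitLimit_eq_zero_of_polynomials {T : H →L[ℂ] H} (hT : ‖T‖ ≤ 1)
    (hcnu : IsCompletelyNonUnitary T) {η : ℝ} (hη : 0 < η)
    (hv : ∀ (x : H) (δ : ℝ), 0 < δ → ∃ v : Polynomial ℂ,
      (∀ z : ℂ, ‖z‖ = 1 → ‖v.eval z‖ ≤ 1) ∧ η ≤ ‖v.eval 0‖ ∧
        orbitLimit T (Polynomial.aeval T v x) ≤ δ) (x : H) :
    orbitLimit T x = 0 := by
  obtain ⟨A, hA⟩ := exists_asymptoticLimit hT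
  refine orbitLimit_eq_zero_of_approx hT hcnu hA (fun y ε hε => ?_) x
  set ε' : ℝ := ε / (2 * (1 + ‖y‖))
  have hε' : 0 < ε' := by positivity
  have hε'ε : ε' ≤ ε := div_le_self hε.le (by linarith [norm_nonneg y])
  have hε'y : ε' * ‖y‖ ≤ ε / 2 := by
    simp only [ε']
    rw [div_mul_eq_mul_div, div_le_div_iff₀ (by positivity) two_pos]
    nlinarith [norm_nonneg y]
  -- `M` depends only on `η` and `ε'`, so `v` may be chosen afterwards with an error that absorbs
  -- `M²`.
  obtain ⟨M, hM, hpoly⟩ := exists_polynomial_near_conj hη hε'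
  obtain ⟨v, hv1, hv0, hvx⟩ := hv y (ε ^ 2 / (4 * (M ^ 2 + 1))) (by positivity)
  obtain ⟨q, hq1, hq⟩ := hpoly v hv1 hv0
  refine ⟨Polynomial.aeval T q y, ?_, ?_⟩
  · exact (norm_aeval_apply_le hq1 hT y).trans
      (mul_le_mul_of_nonneg_right (by linarith) (norm_nonneg _))
  have e : A (T (Polynomial.aeval T q y)) - A y
      = A (Polynomial.aeval T (Polynomial.X * q - 1) y) := by
    rw [← map_sub]
    simp
  rw [e]
  refine le_of_sq_le_sq ((norm_sq_asymptoticLimit_le hT hA _).trans ?_) hε.le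
  -- From `|zq - 1|² ≤ (ε' + M|v|)² ≤ 2ε'² + 2M²|v|²`; each of the two resulting terms is at most
  -- `ε²/2`.
  have h1 := orbitLimit_aeval_le (f := Polynomial.X * q - 1) (v := v) (α := 2 * ε' ^ 2)
    (β := 2 * M ^ 2) (by positivity) (by positivity) (fun z hz => by
      have h2 := pow_le_pow_left₀ (norm_nonneg _) (hq z hz) 2
      nlinarith [sq_nonneg (ε' - M * ‖v.eval z‖)]) hT y
  have h3 : 2 * ε' ^ 2 * orbitLimit T y ≤ ε ^ 2 / 2 := by
    have := mul_le_mul_of_nonneg_left (orbitLimit_le T y) (by positivity : 0 ≤ 2 * ε' ^ 2)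
    have := pow_le_pow_left₀ (by positivity) hε'y 2
    nlinarith
  have h4 : 2 * M ^ 2 * orbitLimit T (Polynomial.aeval T v y) ≤ ε ^ 2 / 2 := by
    refine (mul_le_mul_of_nonneg_left hvx (by positivity)).trans ?_
    rw [mul_div_assoc', div_le_div_iff₀ (by positivity) two_pos]
    nlinarith [sq_nonneg ε, sq_nonneg M]
  linarith

end AsymptoticLimit

/-! ### Taylor coefficients and dilated Taylor polynomials. -/

section TaylorCoefficients

theorem zeroExt_coe (f : OpenDisc → ℂ) (z : OpenDisc) : zeroExt f z = f z :=
  zeroExt_eq_of_mem f z.2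

theorem zeroExt_mul (f g : OpenDisc → ℂ) : zeroExt (f * g) = zeroExt f * zeroExt g := by
  funext z
  by_cases hz : z ∈ Metric.ball (0 : ℂ) 1
  · simp [zeroExt_eq_of_mem _ hz]
  · simp only [zeroExt, dif_neg hz, Pi.mul_apply, mul_zero]

theorem zeroExt_sub (f g : OpenDisc → ℂ) : zeroExt (f - g) = zeroExt f - zeroExt g := by
  funext z
  by_cases hz : z ∈ Metric.ball (0 : ℂ) 1
  · simp [zeroExt_eq_of_mem _ hz]
  · simp only [zeroExt, dif_neg hz, Pi.sub_apply, sub_zero]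

theorem HInfty.differentiableOn (u : HInfty) :
    DifferentiableOn ℂ (zeroExt u.1) (Metric.ball 0 1) := u.2.1

theorem HInfty.analyticOnNhd (u : HInfty) :
    AnalyticOnNhd ℂ (zeroExt u.1) (Metric.ball 0 1) :=
  u.differentiableOn.analyticOnNhd Metric.isOpen_ball

theorem norm_le_supNorm (u : HInfty) (z : OpenDisc) : ‖u.1 z‖ ≤ supNorm u := by
  obtain ⟨M, hM⟩ := u.2.2
  exact le_ciSup (f := fun z : OpenDisc => ‖u.1 z‖) ⟨M, by rintro _ ⟨w, rfl⟩; exact hM w⟩ z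

theorem supNorm_nonneg (u : HInfty) : 0 ≤ supNorm u :=
  Real.iSup_nonneg fun _ => norm_nonneg _

theorem hasSum_taylorCoeff (u : HInfty) {z : ℂ} (hz : ‖z‖ < 1) :
    HasSum (fun n => taylorCoeff u n * z ^ n) (zeroExt u.1 z) := by
  have := Complex.hasSum_taylorSeries_on_ball u.differentiableOn (z := z) (by simpa using hz)
  refine this.congr_fun fun n => ?_
  rw [taylorCoeff, sub_zero, smul_eq_mul, smul_eq_mul]
  ring

theorem contDiffAt_zeroExt (u : HInfty) (n : ℕ) : ContDiffAt ℂ n (zeroExt u.1) 0 :=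
  (u.analyticOnNhd 0 (Metric.mem_ball_self one_pos)).contDiffAt

theorem taylorCoeff_sub (u v : HInfty) (n : ℕ) :
    taylorCoeff (u - v) n = taylorCoeff u n - taylorCoeff v n := by
  have : (u - v).1 = u.1 - v.1 := rfl
  rw [taylorCoeff, this, zeroExt_sub,
    iteratedDeriv_sub (contDiffAt_zeroExt u n) (contDiffAt_zeroExt v n), sub_div]
  rfl

theorem taylorCoeff_mul (u v : HInfty) (n : ℕ) :
    taylorCoeff (u * v) n
      = ∑ p ∈ Finset.HasAntidiagonal.antidiagonal n, taylorCoeff u p.1 * taylorCoeff v p.2 := by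
  have : (u * v).1 = u.1 * v.1 := rfl
  rw [taylorCoeff, this, zeroExt_mul,
    iteratedDeriv_mul (contDiffAt_zeroExt u n) (contDiffAt_zeroExt v n),
    Finset.Nat.sum_antidiagonal_eq_sum_range_succ_mk, Finset.sum_div]
  refine Finset.sum_congr rfl fun i hi => ?_
  rw [Finset.mem_range] at hi
  rw [taylorCoeff, taylorCoeff, Nat.cast_choose ℂ (by omega : i ≤ n)]
  have := Nat.cast_ne_zero (R := ℂ).2 n.factorial_ne_zero
  field_simp

theorem taylorCoeff_one (n : ℕ) : taylorCoeff 1 n = if n = 0 then 1 else 0 := by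
  have : zeroExt (1 : HInfty).1 =ᶠ[𝓝 0] fun _ => (1 : ℂ) := by
    filter_upwards [Metric.ball_mem_nhds (0 : ℂ) one_pos] with z hz
    rw [zeroExt_eq_of_mem _ hz]; rfl
  rw [taylorCoeff, this.iteratedDeriv_eq, iteratedDeriv_const]
  split_ifs with h <;> simp [h]

theorem summable_norm_taylorCoeff (u : HInfty) {r : ℝ} (h0 : 0 ≤ r) (h1 : r < 1) :
    Summable fun n => ‖taylorCoeff u n * (r : ℂ) ^ n‖ :=
  (hasSum_taylorCoeff u (by rwa [Complex.norm_real, Real.norm_of_nonneg h0])).summable.norm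

theorem exists_taylorCoeff_ne_zero {u : HInfty} (hu : u ≠ 0) : ∃ n, taylorCoeff u n ≠ 0 := by
  by_contra! h
  refine hu (Subtype.ext (funext fun z => ?_))
  have hz : ‖(z : ℂ)‖ < 1 := mem_ball_zero_iff.1 z.2
  have := hasSum_taylorCoeff u hz
  simp only [h, zero_mul] at this
  rw [← zeroExt_coe u.1 z, this.unique hasSum_zero]
  rfl

/-- The Taylor polynomial of `z ↦ u (r z)`. -/
def dilatedTaylor (u : HInfty) (r : ℝ) (N : ℕ) : Polynomial ℂ :=
  ∑ n ∈ Finset.range N, Polynomial.C (taylorCoeff u n * (r : ℂ) ^ n) * Polynomial.X ^ n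

theorem coeff_dilatedTaylor (u : HInfty) (r : ℝ) (N k : ℕ) :
    (dilatedTaylor u r N).coeff k = if k < N then taylorCoeff u k * (r : ℂ) ^ k else 0 := by
  simp only [dilatedTaylor, Polynomial.finsetSum_coeff, Polynomial.coeff_C_mul,
    Polynomial.coeff_X_pow, mul_ite, mul_one, mul_zero, Finset.sum_ite_eq, Finset.mem_range]

theorem exists_norm_eval_dilatedTaylor_le (u : HInfty) {r : ℝ} (h0 : 0 ≤ r) (h1 : r < 1) :
    ∃ τ : ℕ → ℝ, Tendsto τ atTop (𝓝 0) ∧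
      ∀ N (z : ℂ), ‖z‖ = 1 → ‖(dilatedTaylor u r N).eval z‖ ≤ supNorm u + τ N := by
  refine ⟨fun N => ∑' n, ‖taylorCoeff u (n + N) * (r : ℂ) ^ (n + N)‖,
    tendsto_sum_nat_add fun n => ‖taylorCoeff u n * (r : ℂ) ^ n‖, fun N z hz => ?_⟩
  have hrz : ‖(r : ℂ) * z‖ < 1 := by
    rwa [norm_mul, hz, mul_one, Complex.norm_real, Real.norm_of_nonneg h0]
  have hs := hasSum_taylorCoeff u hrz
  have hsum := hs.summable.sum_add_tsum_nat_add N
  rw [hs.tsum_eq] at hsum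
  have heval : (dilatedTaylor u r N).eval z
      = ∑ n ∈ Finset.range N, taylorCoeff u n * ((r : ℂ) * z) ^ n := by
    rw [dilatedTaylor, Polynomial.eval_finsetSum]
    refine Finset.sum_congr rfl fun n _ => ?_
    simp [mul_pow, mul_assoc]
  rw [heval, eq_sub_of_add_eq hsum]
  refine (norm_sub_le _ _).trans (add_le_add ?_ ?_)
  · have hm : (r : ℂ) * z ∈ Metric.ball (0 : ℂ) 1 := by simpa using hrz
    rw [zeroExt_eq_of_mem _ hm]
    exact norm_le_supNorm u _
  · refine tsum_of_norm_bounded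
      ((summable_nat_add_iff N).2 (summable_norm_taylorCoeff u h0 h1)).hasSum fun n => le_of_eq ?_
    rw [norm_mul, norm_mul, norm_pow, norm_pow, norm_mul, hz, mul_one]

end TaylorCoefficients

/-! ### Existence and multiplicativity of the functional calculus. -/

section Calculus

variable {H : Type*} [NormedAddCommGroup H] [InnerProductSpace ℂ H] [CompleteSpace H]

omit [CompleteSpace H] in
theorem norm_dilatedEval_term_le {T : H →L[ℂ] H} (hT : ‖T‖ ≤ 1) (u : HInfty) (r : ℝ) (n : ℕ) :
    ‖(taylorCoeff u n * (r : ℂ) ^ n) • T ^ n‖ ≤ ‖taylorCoeff u n * (r : ℂ) ^ n‖ := by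
  rw [norm_smul]
  refine mul_le_of_le_one_right (norm_nonneg _) ?_
  exact ContinuousLinearMap.opNorm_le_bound _ zero_le_one fun x => by
    simpa using norm_pow_apply_le hT n x

theorem hasSum_dilatedEval {T : H →L[ℂ] H} (hT : ‖T‖ ≤ 1) (u : HInfty) {r : ℝ} (h0 : 0 ≤ r)
    (h1 : r < 1) :
    HasSum (fun n => (taylorCoeff u n * (r : ℂ) ^ n) • T ^ n) (dilatedEval T u r) :=
  (Summable.of_norm_bounded (summable_norm_taylorCoeff u h0 h1)
    (norm_dilatedEval_term_le hT u r)).hasSum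

omit [CompleteSpace H] in
theorem aeval_dilatedTaylor (T : H →L[ℂ] H) (u : HInfty) (r : ℝ) (N : ℕ) :
    Polynomial.aeval T (dilatedTaylor u r N)
      = ∑ n ∈ Finset.range N, (taylorCoeff u n * (r : ℂ) ^ n) • T ^ n := by
  rw [dilatedTaylor, map_sum]
  refine Finset.sum_congr rfl fun n _ => ?_
  rw [map_mul, Polynomial.aeval_C, map_pow, Polynomial.aeval_X, Algebra.smul_def]

theorem tendsto_aeval_dilatedTaylor {T : H →L[ℂ] H} (hT : ‖T‖ ≤ 1) (u : HInfty) {r : ℝ}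
    (h0 : 0 ≤ r) (h1 : r < 1) (x : H) :
    Tendsto (fun N => Polynomial.aeval T (dilatedTaylor u r N) x) atTop
      (𝓝 (dilatedEval T u r x)) := by
  simp only [aeval_dilatedTaylor]
  exact ((ContinuousLinearMap.apply ℂ H x).continuous.tendsto _).comp
    (hasSum_dilatedEval hT u h0 h1).tendsto_sum_nat

theorem dilatedEval_sub {T : H →L[ℂ] H} (hT : ‖T‖ ≤ 1) (u v : HInfty) {r : ℝ} (h0 : 0 ≤ r)
    (h1 : r < 1) : dilatedEval T (u - v) r = dilatedEval T u r - dilatedEval T v r := by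
  refine (hasSum_dilatedEval hT _ h0 h1).unique
    (((hasSum_dilatedEval hT u h0 h1).sub (hasSum_dilatedEval hT v h0 h1)).congr_fun fun n => ?_)
  rw [taylorCoeff_sub, ← sub_smul, sub_mul]

theorem dilatedEval_mul {T : H →L[ℂ] H} (hT : ‖T‖ ≤ 1) (u v : HInfty) {r : ℝ} (h0 : 0 ≤ r)
    (h1 : r < 1) : dilatedEval T (u * v) r = dilatedEval T u r * dilatedEval T v r := by
  have hs : ∀ w : HInfty, Summable fun n => ‖(taylorCoeff w n * (r : ℂ) ^ n) • T ^ n‖ := fun w =>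
    Summable.of_nonneg_of_le (fun _ => norm_nonneg _) (norm_dilatedEval_term_le hT w r)
      (summable_norm_taylorCoeff w h0 h1)
  rw [dilatedEval, dilatedEval, dilatedEval,
    tsum_mul_tsum_eq_tsum_sum_antidiagonal_of_summable_norm (hs u) (hs v)]
  refine tsum_congr fun n => ?_
  rw [taylorCoeff_mul, Finset.sum_mul, Finset.sum_smul]
  refine Finset.sum_congr rfl fun p hp => ?_
  rw [Finset.HasAntidiagonal.mem_antidiagonal] at hp
  rw [smul_mul_smul_comm, ← pow_add, hp, ← hp, pow_add]
  congr 1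
  ring

omit [CompleteSpace H] in
theorem dilatedEval_one (T : H →L[ℂ] H) (r : ℝ) : dilatedEval T 1 r = 1 := by
  rw [dilatedEval, tsum_eq_single 0]
  · simp [taylorCoeff_one]
  · intro n hn
    simp [taylorCoeff_one, hn]

theorem norm_dilatedEval_apply_le {T : H →L[ℂ] H} (hT : ‖T‖ ≤ 1) (u : HInfty) {r : ℝ}
    (h0 : 0 ≤ r) (h1 : r < 1) (x : H) : ‖dilatedEval T u r x‖ ≤ supNorm u * ‖x‖ := by
  obtain ⟨τ, hτ, hle⟩ := exists_norm_eval_dilatedTaylor_le u h0 h1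
  have hlim : Tendsto (fun N => (supNorm u + τ N) * ‖x‖) atTop (𝓝 ((supNorm u + 0) * ‖x‖)) :=
    (hτ.const_add _).mul_const _
  rw [add_zero] at hlim
  exact le_of_tendsto_of_tendsto' (tendsto_aeval_dilatedTaylor hT u h0 h1 x).norm hlim fun N =>
    norm_aeval_apply_le (hle N) hT x

/-- Split `f = p + X^N g`, with `p` the first `N` terms. On the circle `|g| = |f - p|`, and `g(T)`
acts on `T^N x`. If `T^N x` is small, only finitely many coefficients of `f` matter. -/
theorem norm_aeval_apply_le_of_coeff {f : Polynomial ℂ} {L : ℝ}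
    (h : ∀ z : ℂ, ‖z‖ = 1 → ‖f.eval z‖ ≤ L) {T : H →L[ℂ] H} (hT : ‖T‖ ≤ 1) (N : ℕ) (x : H) :
    ‖Polynomial.aeval T f x‖ ≤ (∑ k ∈ Finset.range N, ‖f.coeff k‖) * ‖x‖
      + (L + ∑ k ∈ Finset.range N, ‖f.coeff k‖) * ‖(T ^ N) x‖ := by
  set p : Polynomial ℂ := ∑ k ∈ Finset.range N, Polynomial.C (f.coeff k) * Polynomial.X ^ k
  have hp : ∀ z : ℂ, ‖z‖ = 1 → ‖p.eval z‖ ≤ ∑ k ∈ Finset.range N, ‖f.coeff k‖ := by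
    intro z hz
    rw [Polynomial.eval_finsetSum]
    refine norm_sum_le_of_le _ fun k _ => ?_
    simp [hz]
  obtain ⟨g, hg⟩ : Polynomial.X ^ N ∣ f - p := by
    rw [Polynomial.X_pow_dvd_iff]
    intro d hd
    simp [p, Polynomial.finsetSum_coeff, Polynomial.coeff_X_pow, hd]
  have hgb : ∀ z : ℂ, ‖z‖ = 1 → ‖g.eval z‖ ≤ L + ∑ k ∈ Finset.range N, ‖f.coeff k‖ := by
    intro z hz
    have h1 := congrArg (fun q => ‖Polynomial.eval z q‖) hg
    simp only [Polynomial.eval_sub, Polynomial.eval_mul, Polynomial.eval_pow, Polynomial.eval_X,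
      norm_mul, norm_pow, hz, one_pow, one_mul] at h1
    rw [← h1]
    exact (norm_sub_le _ _).trans (add_le_add (h z hz) (hp z hz))
  have hf : f = p + g * Polynomial.X ^ N := by rw [mul_comm, ← hg]; ring
  have : Polynomial.aeval T f x = Polynomial.aeval T p x + Polynomial.aeval T g ((T ^ N) x) := by
    conv_lhs => rw [hf]
    simp
  rw [this]
  exact (norm_add_le _ _).trans
    (add_le_add (norm_aeval_apply_le hp hT x) (norm_aeval_apply_le hgb hT _))

theorem norm_dilatedEval_sub_apply_le {T : H →L[ℂ] H} (hT : ‖T‖ ≤ 1) (u : HInfty) {r s : ℝ}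
    (hr0 : 0 ≤ r) (hr1 : r < 1) (hs0 : 0 ≤ s) (hs1 : s < 1) (N : ℕ) (x : H) :
    ‖dilatedEval T u r x - dilatedEval T u s x‖
      ≤ (∑ k ∈ Finset.range N, ‖taylorCoeff u k * (r : ℂ) ^ k - taylorCoeff u k * (s : ℂ) ^ k‖)
          * ‖x‖
        + (2 * supNorm u + ∑ k ∈ Finset.range N,
          ‖taylorCoeff u k * (r : ℂ) ^ k - taylorCoeff u k * (s : ℂ) ^ k‖) * ‖(T ^ N) x‖ := by
  obtain ⟨τ, hτ, hle⟩ := exists_norm_eval_dilatedTaylor_le u hr0 hr1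
  obtain ⟨σ, hσ, hle'⟩ := exists_norm_eval_dilatedTaylor_le u hs0 hs1
  set c := ∑ k ∈ Finset.range N, ‖taylorCoeff u k * (r : ℂ) ^ k - taylorCoeff u k * (s : ℂ) ^ k‖
  have hlim : Tendsto (fun K => c * ‖x‖ + (supNorm u + τ K + (supNorm u + σ K) + c) * ‖(T ^ N) x‖)
      atTop (𝓝 (c * ‖x‖ + (supNorm u + 0 + (supNorm u + 0) + c) * ‖(T ^ N) x‖)) :=
    (((((hτ.const_add _).add (hσ.const_add _))).add_const _).mul_const _).const_add _
  rw [add_zero, ← two_mul] at hlim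
  refine le_of_tendsto_of_tendsto ((tendsto_aeval_dilatedTaylor hT u hr0 hr1 x).sub
    (tendsto_aeval_dilatedTaylor hT u hs0 hs1 x)).norm hlim ?_
  filter_upwards [eventually_ge_atTop N] with K hK
  have h1 : ∀ z : ℂ, ‖z‖ = 1 → ‖(dilatedTaylor u r K - dilatedTaylor u s K).eval z‖
      ≤ supNorm u + τ K + (supNorm u + σ K) := fun z hz => by
    rw [Polynomial.eval_sub]
    exact (norm_sub_le _ _).trans (add_le_add (hle K z hz) (hle' K z hz))
  have h2 := norm_aeval_apply_le_of_coeff h1 hT N x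
  have h3 : ∑ k ∈ Finset.range N, ‖(dilatedTaylor u r K - dilatedTaylor u s K).coeff k‖ = c := by
    refine Finset.sum_congr rfl fun k hk => ?_
    rw [Finset.mem_range] at hk
    rw [Polynomial.coeff_sub, coeff_dilatedTaylor, coeff_dilatedTaylor, if_pos (by omega),
      if_pos (by omega)]
  rw [h3, map_sub] at h2
  exact h2

theorem eventually_nonneg_lt_one : ∀ᶠ r : ℝ in 𝓝[<] 1, 0 ≤ r ∧ r < 1 := by
  filter_upwards [Ioo_mem_nhdsLT (zero_lt_one (α := ℝ))] with r hr
  exact ⟨hr.1.le, hr.2⟩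

theorem cauchy_dilatedEval {T : H →L[ℂ] H} (hT : ‖T‖ ≤ 1) (u : HInfty) {x : H}
    (hx : Tendsto (fun n : ℕ => (T ^ n) x) atTop (𝓝 0)) :
    Cauchy (map (fun r : ℝ => dilatedEval T u r x) (𝓝[<] 1)) := by
  rw [Metric.cauchy_iff]
  refine ⟨inferInstance, fun ε hε => ?_⟩
  have hB : 0 < 2 * supNorm u + 1 := by linarith [supNorm_nonneg u]
  -- First `N` makes the tail acting on `T^N x` small uniformly in `r` and `s`; then `r, s → 1`
  -- makes the first `N` coefficients of the difference small.
  obtain ⟨N, hN⟩ := ((tendsto_zero_iff_norm_tendsto_zero.1 hx).eventually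
    (gt_mem_nhds (show 0 < ε / (2 * (2 * supNorm u + 1)) by positivity))).exists
  set δ : ℝ → ℝ := fun r =>
    ∑ k ∈ Finset.range N, ‖taylorCoeff u k * (r : ℂ) ^ k - taylorCoeff u k‖
  have hδ : Tendsto δ (𝓝[<] 1) (𝓝 0) := by
    have h1 : Continuous δ := by
      have : Continuous (fun r : ℝ => (r : ℂ)) := Complex.continuous_ofReal
      fun_prop
    have h2 : δ 1 = 0 := by simp [δ]
    rw [← h2]
    exact (h1.tendsto 1).mono_left nhdsWithin_le_nhds
  set κ : ℝ := min 1 (ε / (2 * (‖x‖ + 1))) / 2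
  have hκ : 0 < κ := by positivity
  have hev := (hδ.eventually (gt_mem_nhds hκ)).and eventually_nonneg_lt_one
  refine ⟨_, image_mem_map hev, ?_⟩
  rintro _ ⟨r, ⟨hr, hr0, hr1⟩, rfl⟩ _ ⟨s, ⟨hs, hs0, hs1⟩, rfl⟩
  rw [dist_eq_norm]
  refine (norm_dilatedEval_sub_apply_le hT u hr0 hr1 hs0 hs1 N x).trans_lt ?_
  set c := ∑ k ∈ Finset.range N, ‖taylorCoeff u k * (r : ℂ) ^ k - taylorCoeff u k * (s : ℂ) ^ k‖
  have hc : c ≤ 2 * κ := by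
    have : c ≤ δ r + δ s := by
      simp only [c, δ]
      rw [← Finset.sum_add_distrib]
      refine Finset.sum_le_sum fun k _ => ?_
      have := norm_sub_le (taylorCoeff u k * (r : ℂ) ^ k - taylorCoeff u k)
        (taylorCoeff u k * (s : ℂ) ^ k - taylorCoeff u k)
      rwa [sub_sub_sub_cancel_right] at this
    linarith
  have hc1 : c ≤ 1 := hc.trans (by simp only [κ]; linarith [min_le_left 1 (ε / (2 * (‖x‖ + 1)))])
  have hc2 : c ≤ ε / (2 * (‖x‖ + 1)) :=
    hc.trans (by simp only [κ]; linarith [min_le_right 1 (ε / (2 * (‖x‖ + 1)))])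
  have h1 : c * ‖x‖ ≤ ε / 2 := by
    refine (mul_le_mul_of_nonneg_right hc2 (norm_nonneg _)).trans ?_
    rw [div_mul_eq_mul_div, div_le_div_iff₀ (by positivity) two_pos]
    nlinarith [norm_nonneg x]
  have h2 : (2 * supNorm u + c) * ‖(T ^ N) x‖ < ε / 2 := by
    have h3 := mul_le_mul_of_nonneg_right (show 2 * supNorm u + c ≤ 2 * supNorm u + 1 by linarith)
      (norm_nonneg ((T ^ N) x))
    have h4 := mul_lt_mul_of_pos_left hN hB
    have h5 : (2 * supNorm u + 1) * (ε / (2 * (2 * supNorm u + 1))) = ε / 2 := by field_simp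
    linarith
  linarith

theorem exists_isHInftyValue {T : H →L[ℂ] H} (hT : ‖T‖ ≤ 1)
    (h : ∀ x, Tendsto (fun n : ℕ => (T ^ n) x) atTop (𝓝 0)) (u : HInfty) :
    ∃ X, IsHInftyValue T u X := by
  choose X hX using fun x => cauchy_map_iff_exists_tendsto.1 (cauchy_dilatedEval hT u (h x))
  exact ⟨continuousLinearMapOfTendsto (fun r => dilatedEval T u r) (tendsto_pi_nhds.2 hX), hX⟩

omit [CompleteSpace H] in
theorem IsHInftyValue.unique {T X Y : H →L[ℂ] H} {u : HInfty} (hX : IsHInftyValue T u X)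
    (hY : IsHInftyValue T u Y) : X = Y :=
  ContinuousLinearMap.ext fun x => tendsto_nhds_unique (hX x) (hY x)

omit [CompleteSpace H] in
theorem IsHInftyValue.hInftyCalc_eq {T X : H →L[ℂ] H} {u : HInfty} (hX : IsHInftyValue T u X) :
    hInftyCalc T u = X := by
  have h : ∃ X, IsHInftyValue T u X := ⟨X, hX⟩
  rw [hInftyCalc, dif_pos h]
  exact h.choose_spec.unique hX

theorem IsHInftyValue.sub {T X Y : H →L[ℂ] H} (hT : ‖T‖ ≤ 1) {u v : HInfty}
    (hX : IsHInftyValue T u X) (hY : IsHInftyValue T v Y) : IsHInftyValue T (u - v) (X - Y) := by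
  intro x
  refine ((hX x).sub (hY x)).congr' ?_
  filter_upwards [eventually_nonneg_lt_one] with r hr
  rw [dilatedEval_sub hT u v hr.1 hr.2]
  rfl

theorem IsHInftyValue.mul {T X Y : H →L[ℂ] H} (hT : ‖T‖ ≤ 1) {u v : HInfty}
    (hX : IsHInftyValue T u X) (hY : IsHInftyValue T v Y) : IsHInftyValue T (u * v) (X * Y) := by
  intro x
  -- Strong convergence of both factors suffices because the operators `u(rT)` are bounded by
  -- `supNorm u`, uniformly in `r`.
  have h1 : Tendsto (fun r : ℝ => dilatedEval T u r (dilatedEval T v r x - Y x)) (𝓝[<] 1)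
      (𝓝 0) := by
    have h2 : Tendsto (fun r : ℝ => supNorm u * ‖dilatedEval T v r x - Y x‖) (𝓝[<] 1) (𝓝 0) := by
      simpa using (tendsto_iff_norm_sub_tendsto_zero.1 (hY x)).const_mul (supNorm u)
    refine squeeze_zero_norm' ?_ h2
    filter_upwards [eventually_nonneg_lt_one] with r hr
    exact norm_dilatedEval_apply_le hT u hr.1 hr.2 _
  have h3 := h1.add (hX (Y x))
  rw [zero_add] at h3
  refine h3.congr' ?_
  filter_upwards [eventually_nonneg_lt_one] with r hr
  rw [dilatedEval_mul hT u v hr.1 hr.2, map_sub, sub_add_cancel]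
  rfl

omit [CompleteSpace H] in
theorem isHInftyValue_one (T : H →L[ℂ] H) : IsHInftyValue T 1 1 := by
  intro x
  simp only [dilatedEval_one]
  exact tendsto_const_nhds

omit [CompleteSpace H] in
theorem orbitLimit_pow_apply {T : H →L[ℂ] H} (hT : ‖T‖ ≤ 1) (m : ℕ) (y : H) :
    orbitLimit T ((T ^ m) y) = orbitLimit T y := by
  refine tendsto_nhds_unique (tendsto_orbitLimit hT _)
    (((tendsto_orbitLimit hT y).comp (tendsto_add_atTop_nat m)).congr fun n => ?_)
  simp only [Function.comp_apply]
  rw [pow_add, mul_apply_eq_comp]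

/-- The powers of a contraction of class `C₀` tend strongly to zero. -/
theorem IsClassC0.tendsto_pow {T : H →L[ℂ] H} (hT : IsClassC0 T) (x : H) :
    Tendsto (fun n : ℕ => (T ^ n) x) atTop (𝓝 0) := by
  classical
  obtain ⟨hT1, hcnu, u, hu, hval⟩ := hT
  have hex := exists_taylorCoeff_ne_zero hu
  set m := Nat.find hex
  have hm : taylorCoeff u m ≠ 0 := Nat.find_spec hex
  have hlt : ∀ k < m, taylorCoeff u k = 0 := fun k hk => not_not.1 (Nat.find_min hex hk)
  set L := supNorm u + 1
  have hL : 0 < L := by linarith [supNorm_nonneg u]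
  -- A lower bound at the origin that holds for every `r > 1/2`; it must not depend on the vector or
  -- on `δ`.
  have hη : 0 < ‖taylorCoeff u m‖ * (1 / 2) ^ m / L := by positivity
  have h0 : orbitLimit T x = 0 := by
    refine orbitLimit_eq_zero_of_polynomials hT1 hcnu hη (fun y δ hδ => ?_) x
    have hr1 := (tendsto_zero_iff_norm_tendsto_zero.1 (hval y)).eventually
      (gt_mem_nhds (show 0 < L * Real.sqrt δ by positivity))
    obtain ⟨r, hr, hr2, hr1⟩ :=
      (hr1.and (Ioo_mem_nhdsLT (show (1 / 2 : ℝ) < 1 by norm_num))).exists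
    have hr0 : 0 ≤ r := by linarith
    obtain ⟨τ, hτ, hle⟩ := exists_norm_eval_dilatedTaylor_le u hr0 hr1
    obtain ⟨N, hN1, hN2, hN3⟩ := ((hτ.eventually (gt_mem_nhds one_pos)).and
      (((tendsto_aeval_dilatedTaylor hT1 u hr0 hr1 y).norm.eventually (gt_mem_nhds hr)).and
        (eventually_gt_atTop m))).exists
    obtain ⟨w, hw⟩ : Polynomial.X ^ m ∣ dilatedTaylor u r N := by
      rw [Polynomial.X_pow_dvd_iff]
      intro k hk
      rw [coeff_dilatedTaylor, hlt k hk, zero_mul, ite_self]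
    have hw0 : w.eval 0 = taylorCoeff u m * (r : ℂ) ^ m := by
      have := coeff_dilatedTaylor u r N m
      rw [if_pos hN3, hw, Polynomial.coeff_X_pow_mul', if_pos le_rfl, Nat.sub_self] at this
      rw [← Polynomial.coeff_zero_eq_eval_zero, this]
    have hLC : ‖((L : ℂ))⁻¹‖ = L⁻¹ := by rw [norm_inv, Complex.norm_real, Real.norm_of_nonneg hL.le]
    -- The witness is the Taylor polynomial of `u(rz)` divided by `X^m` and normalised by `L`.
    -- Removing `X^m` makes the value at 0 nonzero and costs nothing, since `orbitLimit` is
    -- invariant under `T^m`.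
    refine ⟨Polynomial.C ((L : ℂ)⁻¹) * w, fun z hz => ?_, ?_, ?_⟩
    · have h1 := hle N z hz
      rw [hw, Polynomial.eval_mul, norm_mul, Polynomial.eval_pow, Polynomial.eval_X, norm_pow, hz,
        one_pow, one_mul] at h1
      rw [Polynomial.eval_mul, Polynomial.eval_C, norm_mul, hLC, inv_mul_le_iff₀ hL, mul_one]
      linarith
    · rw [Polynomial.eval_mul, Polynomial.eval_C, norm_mul, hLC, hw0, norm_mul, norm_pow,
        Complex.norm_real, Real.norm_of_nonneg hr0, div_eq_inv_mul]
      gcongr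
    · rw [← orbitLimit_pow_apply hT1 m]
      have e : (T ^ m) (Polynomial.aeval T (Polynomial.C ((L : ℂ)⁻¹) * w) y)
          = (L : ℂ)⁻¹ • Polynomial.aeval T (dilatedTaylor u r N) y := by
        rw [hw]
        simp [Algebra.algebraMap_eq_smul_one]
      rw [e]
      refine (orbitLimit_le _ _).trans ?_
      rw [norm_smul, hLC, ← Real.sq_sqrt hδ.le]
      refine pow_le_pow_left₀ (by positivity) ?_ 2
      rw [inv_mul_le_iff₀ hL]
      exact hN2.le
  have h1 := tendsto_orbitLimit hT1 x
  rw [h0] at h1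
  rw [tendsto_zero_iff_norm_tendsto_zero]
  have h2 := (Real.continuous_sqrt.tendsto 0).comp h1
  simpa [Function.comp_def, Real.sqrt_sq] using h2

end Calculus

/-! ### `H^∞` is an integral domain and inner functions are nonzero. -/

section Domain

instance : Nontrivial HInfty :=
  ⟨0, 1, fun h => zero_ne_one (congrFun (congrArg Subtype.val h)
    ⟨(0 : ℂ), Metric.mem_ball_self one_pos⟩ : (0 : ℂ) = 1)⟩

theorem HInfty.eq_zero_of_zeroExt {u : HInfty}
    (h : ∀ z ∈ Metric.ball (0 : ℂ) 1, zeroExt u.1 z = 0) : u = 0 :=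
  Subtype.ext (funext fun z => (zeroExt_coe u.1 z).symm.trans (h z z.2))

instance : NoZeroDivisors HInfty where
  eq_zero_or_eq_zero_of_mul_eq_zero := by
    intro u v h
    have h0 : ∀ z ∈ Metric.ball (0 : ℂ) 1, zeroExt u.1 z * zeroExt v.1 z = 0 := by
      intro z hz
      rw [zeroExt_eq_of_mem _ hz, zeroExt_eq_of_mem _ hz]
      exact congrFun (congrArg Subtype.val h) ⟨z, hz⟩
    exact (u.analyticOnNhd.eq_zero_or_eq_zero_of_mul_eq_zero v.analyticOnNhd h0
      (convex_ball _ _).isPreconnected).imp HInfty.eq_zero_of_zeroExt HInfty.eq_zero_of_zeroExt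

theorem IsInner.ne_zero {u : HInfty} (hu : IsInner u) : u ≠ 0 := by
  rintro rfl
  obtain ⟨t, c, hc, ht⟩ := hu.2.exists
  have h0 : zeroExt (0 : HInfty).1 = fun _ => 0 := by
    funext z
    unfold zeroExt
    split_ifs <;> rfl
  rw [h0] at ht
  rw [tendsto_nhds_unique ht tendsto_const_nhds, norm_zero] at hc
  exact zero_ne_one hc

end Domain

/-! ### Dividing a convergent sequence by a fixed nonzero function. -/

section Division

theorem HInfty.eventually_ne_zero {F : HInfty} (hF : F ≠ 0) {z₀ : ℂ}
    (hz₀ : z₀ ∈ Metric.ball (0 : ℂ) 1) : ∀ᶠ z in 𝓝[≠] z₀, zeroExt F.1 z ≠ 0 := by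
  refine (F.analyticOnNhd z₀ hz₀).eventually_eq_zero_or_eventually_ne_zero.resolve_left fun h => ?_
  exact hF (HInfty.eq_zero_of_zeroExt fun z hz =>
    F.analyticOnNhd.eqOn_zero_of_preconnected_of_eventuallyEq_zero
      (convex_ball _ _).isPreconnected hz₀ h hz)

theorem HInfty.exists_sphere_ne_zero {F : HInfty} (hF : F ≠ 0) {z₀ : ℂ}
    (hz₀ : z₀ ∈ Metric.ball (0 : ℂ) 1) :
    ∃ R : NNReal, 0 < R ∧ Metric.closedBall z₀ R ⊆ Metric.ball 0 1 ∧
      ∀ z ∈ Metric.sphere z₀ (R : ℝ), zeroExt F.1 z ≠ 0 := by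
  have h1 := eventually_nhdsWithin_iff.1 (HInfty.eventually_ne_zero hF hz₀)
  obtain ⟨ε, hε, hball⟩ := Metric.eventually_nhds_iff_ball.1
    (h1.and (Metric.isOpen_ball.eventually_mem hz₀))
  have hR : 0 < ε / 2 := by positivity
  have hsub : Metric.closedBall z₀ (ε / 2) ⊆ Metric.ball z₀ ε :=
    Metric.closedBall_subset_ball (by linarith)
  refine ⟨⟨ε / 2, hR.le⟩, hR, fun z hz => (hball z (hsub hz)).2, fun z hz => ?_⟩
  refine (hball z (hsub (Metric.sphere_subset_closedBall hz))).1 ?_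
  rintro rfl
  simp only [Metric.mem_sphere, dist_self] at hz
  exact hR.ne hz

theorem tendsto_circleIntegral_cauchy {Q : ℕ → ℂ → ℂ} {g : ℂ → ℂ} {c w : ℂ} {R : ℝ} (hR : 0 ≤ R)
    (hw : w ∈ Metric.ball c R) (hQ : ∀ N, ContinuousOn (Q N) (Metric.sphere c R))
    (hb : ∀ N, ∀ z ∈ Metric.sphere c R, ‖Q N z‖ ≤ 1)
    (hlim : ∀ z ∈ Metric.sphere c R, Tendsto (fun N => Q N z) atTop (𝓝 (g z))) :
    Tendsto (fun N => ∮ z in C(c, R), (z - w)⁻¹ • Q N z) atTop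
      (𝓝 (∮ z in C(c, R), (z - w)⁻¹ • g z)) := by
  have hmem : ∀ t, circleMap c R t ∈ Metric.sphere c R := circleMap_mem_sphere c hR
  have hne : ∀ t, circleMap c R t - w ≠ 0 := fun t h => by
    have h1 := hmem t
    rw [sub_eq_zero.1 h, Metric.mem_sphere] at h1
    rw [Metric.mem_ball] at hw
    exact hw.ne h1
  have hcinv : Continuous fun t => (circleMap c R t - w)⁻¹ :=
    ((continuous_circleMap c R).sub continuous_const).inv₀ hne
  have hderiv : Continuous (deriv (circleMap c R)) := by
    simp only [funext (deriv_circleMap c R)]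
    fun_prop
  refine intervalIntegral.tendsto_integral_filter_of_dominated_convergence
    (fun t => ‖deriv (circleMap c R) t‖ * ‖(circleMap c R t - w)⁻¹‖) ?_ ?_ ?_ ?_
  · refine Eventually.of_forall fun N => Continuous.aestronglyMeasurable ?_
    have : Continuous fun t => Q N (circleMap c R t) :=
      (hQ N).comp_continuous (continuous_circleMap c R) hmem
    exact hderiv.smul (hcinv.smul this)
  · refine Eventually.of_forall fun N => Eventually.of_forall fun t _ => ?_
    rw [norm_smul, norm_smul]
    exact mul_le_mul_of_nonneg_left
      (mul_le_of_le_one_right (norm_nonneg _) (hb N _ (hmem t))) (norm_nonneg _)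
  · exact (hderiv.norm.mul hcinv.norm).intervalIntegrable _ _
  · exact Eventually.of_forall fun t _ => ((hlim _ (hmem t)).const_smul _).const_smul _

/-- If `F Q_N` converges pointwise in the disc to an element of `H^∞`, where `F ≠ 0` and the `Q_N` are
bounded by one, then the `Q_N` converge pointwise to an element of `H^∞`. -/
theorem HInfty.exists_tendsto_of_mul {F u : HInfty} (hF : F ≠ 0) {Q : ℕ → HInfty}
    (hQ : ∀ N z, ‖(Q N).1 z‖ ≤ 1)
    (hlim : ∀ z, Tendsto (fun N => F.1 z * (Q N).1 z) atTop (𝓝 (u.1 z))) :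
    ∃ G : HInfty, ∀ z, Tendsto (fun N => (Q N).1 z) atTop (𝓝 (G.1 z)) := by
  -- At zeros of `F` pointwise division fails. On a small circle avoiding those zeros `Q_N → u/F`
  -- boundedly, and Cauchy's formula with dominated convergence carries the limit, and its
  -- holomorphy, inside.
  have hloc : ∀ z₀ ∈ Metric.ball (0 : ℂ) 1, ∃ (R : ℝ) (g : ℂ → ℂ), 0 < R ∧
      Metric.ball z₀ R ⊆ Metric.ball 0 1 ∧ DifferentiableOn ℂ g (Metric.ball z₀ R) ∧
      ∀ w ∈ Metric.ball z₀ R, Tendsto (fun N => zeroExt (Q N).1 w) atTop (𝓝 (g w)) := by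
    intro z₀ hz₀
    obtain ⟨R, hR, hsub, hne⟩ := HInfty.exists_sphere_ne_zero hF hz₀
    have hsph : Metric.sphere z₀ (R : ℝ) ⊆ Metric.ball 0 1 :=
      Metric.sphere_subset_closedBall.trans hsub
    set h : ℂ → ℂ := fun z => zeroExt u.1 z / zeroExt F.1 z
    have hci : CircleIntegrable h z₀ R := ContinuousOn.circleIntegrable R.coe_nonneg
      ((u.differentiableOn.continuousOn.mono hsph).div
        (F.differentiableOn.continuousOn.mono hsph) hne)
    refine ⟨R, fun w => (2 * Real.pi * Complex.I : ℂ)⁻¹ • ∮ z in C(z₀, R), (z - w)⁻¹ • h z, hR,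
      Metric.ball_subset_closedBall.trans hsub, ?_, fun w hw => ?_⟩
    · have := (hasFPowerSeriesOn_cauchy_integral hci hR).differentiableOn
      rwa [Metric.eball_coe] at this
    · have h1 := tendsto_circleIntegral_cauchy (Q := fun N => zeroExt (Q N).1) (g := h) R.coe_nonneg hw
        (fun N => (Q N).differentiableOn.continuousOn.mono hsph)
        (fun N z hz => by rw [zeroExt_eq_of_mem _ (hsph hz)]; exact hQ N _)
        (fun z hz => by
          have hF0 := hne z hz
          simp only [h, zeroExt_eq_of_mem _ (hsph hz)] at hF0 ⊢
          exact ((hlim ⟨z, hsph hz⟩).div_const _).congr fun N => mul_div_cancel_left₀ _ hF0)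
      refine (h1.const_smul (2 * Real.pi * Complex.I : ℂ)⁻¹).congr fun N => ?_
      have h2 : DiffContOnCl ℂ (zeroExt (Q N).1) (Metric.ball z₀ R) :=
        DifferentiableOn.diffContOnCl ((Q N).differentiableOn.mono
          (by rw [closure_ball _ (by exact_mod_cast hR.ne')]; exact hsub))
      rw [h2.circleIntegral_sub_inv_smul hw, smul_smul, inv_mul_cancel₀, one_smul]
      simp [Real.pi_ne_zero]
  have hex : ∀ z : OpenDisc, ∃ y, Tendsto (fun N => (Q N).1 z) atTop (𝓝 y) := by
    intro z
    obtain ⟨R, g, hR, -, -, hg⟩ := hloc z z.2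
    refine ⟨g z, ?_⟩
    simpa only [zeroExt_coe] using hg z (Metric.mem_ball_self hR)
  choose G hG using hex
  refine ⟨⟨G, fun z₀ hz₀ => ?_, 1, fun z => ?_⟩, hG⟩
  · obtain ⟨R, g, hR, hsub, hdiff, hg⟩ := hloc z₀ hz₀
    have heq : zeroExt G =ᶠ[𝓝 z₀] g := by
      filter_upwards [Metric.ball_mem_nhds z₀ hR] with w hw
      rw [zeroExt_eq_of_mem _ (hsub hw)]
      refine tendsto_nhds_unique (hG ⟨w, hsub hw⟩) ((hg w hw).congr fun N => ?_)
      rw [zeroExt_eq_of_mem _ (hsub hw)]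
    exact ((hdiff.differentiableAt (Metric.ball_mem_nhds z₀ hR)).congr_of_eventuallyEq
      heq).differentiableWithinAt
  · exact le_of_tendsto' (hG z).norm fun N => hQ N z

end Division

/-! ### The products `θ_A` for finite or cofinite `A`. -/

section Products

theorem FinOrCofin.compl {A : Set ℕ} (hA : FinOrCofin A) : FinOrCofin Aᶜ := by
  rcases hA with h | h
  · exact Or.inr (by rwa [compl_compl])
  · exact Or.inl h

theorem FinOrCofin.inter {A B : Set ℕ} (hA : FinOrCofin A) (hB : FinOrCofin B) :
    FinOrCofin (A ∩ B) := by
  rcases hA with hA | hA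
  · exact Or.inl (hA.subset Set.inter_subset_left)
  rcases hB with hB | hB
  · exact Or.inl (hB.subset Set.inter_subset_right)
  · exact Or.inr (by rw [Set.compl_inter]; exact hA.union hB)

theorem FinOrCofin.union {A B : Set ℕ} (hA : FinOrCofin A) (hB : FinOrCofin B) :
    FinOrCofin (A ∪ B) := by
  have := (hA.compl.inter hB.compl).compl
  rwa [← Set.compl_union, compl_compl] at this

theorem FinOrCofin.symmDiff {A B : Set ℕ} (hA : FinOrCofin A) (hB : FinOrCofin B) :
    FinOrCofin (A ∆ B) := by
  have h1 := (hA.inter hB.compl).union (hB.inter hA.compl)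
  simpa only [Set.symmDiff_def, Set.sdiff_eq] using h1

theorem finOrCofin_univ : FinOrCofin Set.univ := Or.inr (by simp)

theorem finOrCofin_empty : FinOrCofin ∅ := Or.inl Set.finite_empty

variable {θ : ℕ → HInfty} {A B : Set ℕ}

theorem IsProductOver.unique {u v : HInfty} (hu : IsProductOver θ A u)
    (hv : IsProductOver θ A v) : u = v :=
  Subtype.ext (funext fun z => tendsto_nhds_unique (hu z) (hv z))

theorem IsProductOver.thetaProd (h : ∃ u, IsProductOver θ A u) :
    IsProductOver θ A (thetaProd θ A) := by
  rw [_root_.thetaProd, dif_pos h]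
  exact h.choose_spec

theorem HInfty.prod_apply (s : Finset ℕ) (θ : ℕ → HInfty) (z : OpenDisc) :
    (∏ n ∈ s, θ n).1 z = ∏ n ∈ s, (θ n).1 z := by
  rw [show (∏ n ∈ s, θ n).1 = ∏ n ∈ s, (θ n).1 from map_prod hInftyAlgebra.val _ _,
    Finset.prod_apply]

theorem isProductOver_of_finite (hA : A.Finite) :
    IsProductOver θ A (∏ n ∈ hA.toFinset, θ n) := by
  classical
  intro z
  rw [HInfty.prod_apply]
  obtain ⟨N₀, hN₀⟩ := hA.bddAbove
  refine tendsto_const_nhds.congr' ?_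
  filter_upwards [eventually_gt_atTop N₀] with N hN
  refine Finset.prod_congr ?_ fun _ _ => rfl
  ext n
  simp only [Set.Finite.mem_toFinset, Finset.mem_filter, Finset.mem_range]
  exact ⟨fun h => ⟨(hN₀ h).trans_lt hN, h⟩, fun h => h.2⟩

theorem IsProductOver.mul {u v : HInfty} (hAB : Disjoint A B) (hu : IsProductOver θ A u)
    (hv : IsProductOver θ B v) : IsProductOver θ (A ∪ B) (u * v) := by
  classical
  intro z
  refine ((hu z).mul (hv z)).congr fun N => ?_
  rw [← Finset.prod_union]
  · refine Finset.prod_congr ?_ fun _ _ => rfl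
    ext n
    simp only [Finset.mem_union, Finset.mem_filter, Set.mem_union]
    tauto
  · rw [Finset.disjoint_filter]
    exact fun n _ ha hb => Set.disjoint_left.1 hAB ha hb

theorem exists_isProductOver_of_compl_finite (hθ : ∀ n, IsInner (θ n))
    (hprod : ∃ u, IsProductOver θ Set.univ u) (hA : Aᶜ.Finite) :
    ∃ u, IsProductOver θ A u := by
  classical
  obtain ⟨u, hu⟩ := hprod
  have hF : ∏ n ∈ hA.toFinset, θ n ≠ 0 := Finset.prod_ne_zero_iff.2 fun n _ => (hθ n).ne_zero
  obtain ⟨N₀, hN₀⟩ := hA.bddAbove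
  suffices h : ∃ G : HInfty, ∀ z, Tendsto
      (fun N => (∏ n ∈ (Finset.range N).filter (· ∈ A), θ n).1 z) atTop (𝓝 (G.1 z)) by
    obtain ⟨G, hG⟩ := h
    refine ⟨G, fun z => (hG z).congr fun N => ?_⟩
    rw [HInfty.prod_apply]
  -- `F` is the finite product over `Aᶜ` and `Q_N` the partial products over `A`; once `N` exceeds
  -- all of `Aᶜ`, `F Q_N` is the full partial product.
  refine HInfty.exists_tendsto_of_mul (u := u) hF (fun N z => ?_) (fun z => ?_)
  · rw [HInfty.prod_apply, norm_prod]
    exact Finset.prod_le_one (fun _ _ => norm_nonneg _) fun n _ => (hθ n).1 z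
  · refine (hu z).congr' ?_
    filter_upwards [eventually_gt_atTop N₀] with N hN
    rw [HInfty.prod_apply, HInfty.prod_apply, ← Finset.prod_union]
    · refine Finset.prod_congr ?_ fun _ _ => rfl
      ext n
      simp only [Set.Finite.mem_toFinset, Finset.mem_filter, Finset.mem_range, Finset.mem_union,
        Set.mem_univ, and_true, Set.mem_compl_iff]
      constructor
      · intro h
        by_cases hn : n ∈ A
        · exact Or.inr ⟨h, hn⟩
        · exact Or.inl hn
      · rintro (h | h)
        · exact (hN₀ h).trans_lt hN
        · exact h.1
    · rw [Finset.disjoint_left]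
      intro n hn hn'
      rw [Set.Finite.mem_toFinset] at hn
      exact hn (Finset.mem_filter.1 hn').2

theorem isProductOver_thetaProd (hθ : ∀ n, IsInner (θ n))
    (hprod : ∃ u, IsProductOver θ Set.univ u) (hA : FinOrCofin A) :
    IsProductOver θ A (thetaProd θ A) := by
  refine IsProductOver.thetaProd ?_
  rcases hA with h | h
  · exact ⟨_, isProductOver_of_finite h⟩
  · exact exists_isProductOver_of_compl_finite hθ hprod h

theorem thetaProd_union (hθ : ∀ n, IsInner (θ n)) (hprod : ∃ u, IsProductOver θ Set.univ u)
    (hA : FinOrCofin A) (hB : FinOrCofin B) (hAB : Disjoint A B) :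
    thetaProd θ (A ∪ B) = thetaProd θ A * thetaProd θ B :=
  (isProductOver_thetaProd hθ hprod (hA.union hB)).unique
    ((isProductOver_thetaProd hθ hprod hA).mul hAB (isProductOver_thetaProd hθ hprod hB))

theorem thetaProd_mul_compl (hθ : ∀ n, IsInner (θ n)) (hprod : ∃ u, IsProductOver θ Set.univ u)
    (hA : FinOrCofin A) : thetaProd θ A * thetaProd θ Aᶜ = thetaProd θ Set.univ := by
  rw [← thetaProd_union hθ hprod hA hA.compl disjoint_compl_right, Set.union_compl_self]

theorem thetaProd_dvd_of_subset (hθ : ∀ n, IsInner (θ n))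
    (hprod : ∃ u, IsProductOver θ Set.univ u) (hA : FinOrCofin A) (hB : FinOrCofin B)
    (hAB : A ⊆ B) : thetaProd θ A ∣ thetaProd θ B := by
  have h := thetaProd_union hθ hprod hA (hB.inter hA.compl)
    (Set.disjoint_left.2 fun n ha hb => hb.2 ha)
  rw [← Set.sdiff_eq, Set.union_sdiff_cancel hAB] at h
  exact ⟨_, h⟩

theorem thetaProd_union_dvd (hθ : ∀ n, IsInner (θ n))
    (hprod : ∃ u, IsProductOver θ Set.univ u) (hA : FinOrCofin A) (hB : FinOrCofin B) :
    thetaProd θ (A ∪ B) ∣ thetaProd θ A * thetaProd θ B := by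
  have h := thetaProd_union hθ hprod hA (hB.inter hA.compl)
    (Set.disjoint_left.2 fun n ha hb => hb.2 ha)
  rw [← Set.sdiff_eq, Set.union_sdiff_self] at h
  rw [h]
  refine mul_dvd_mul_left _ ?_
  exact thetaProd_dvd_of_subset hθ hprod (hB.inter hA.compl) hB Set.sdiff_subset

theorem thetaProd_ne_zero (hθ : ∀ n, IsInner (θ n)) (hprod : ∃ u, IsProductOver θ Set.univ u)
    (h : thetaProd θ Set.univ ≠ 0) (hA : FinOrCofin A) : thetaProd θ A ≠ 0 := by
  rw [← thetaProd_mul_compl hθ hprod hA] at h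
  exact left_ne_zero_of_mul h

/-- The quotient is chosen abstractly, but cancellation in the domain `H^∞` determines it. -/
theorem coTheta_eq (hθ : ∀ n, IsInner (θ n)) (hprod : ∃ u, IsProductOver θ Set.univ u)
    (h : thetaProd θ Set.univ ≠ 0) (hA : FinOrCofin A) : coTheta θ A = thetaProd θ Aᶜ := by
  have hm := thetaProd_mul_compl hθ hprod hA
  have hdvd : thetaProd θ A ∣ thetaProd θ Set.univ := ⟨_, hm.symm⟩
  rw [coTheta, hInftyQuot, dif_pos hdvd]
  exact mul_left_cancel₀ (thetaProd_ne_zero hθ hprod h hA) (hdvd.choose_spec.symm.trans hm.symm)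

end Products

/-- Both `bq` and `b'q` are 1 modulo `p` and 0 modulo `q`. With `p = θ_A` and `q = θ_{Aᶜ}` this is
the independence of `φ_A(T)` from the pair. -/
theorem mul_dvd_sub_mul_of_bezout {R : Type*} [CommRing R] {a b a' b' p q : R}
    (h : a * p + b * q = 1) (h' : a' * p + b' * q = 1) : p * q ∣ b' * q - b * q :=
  ⟨a * b' - a' * b, by linear_combination (b' * q) * (-h) + (b * q) * h'⟩

/-! ### The idempotents `φ_A(T)` and the group of the `k_A`. -/

section Projections

variable {H : Type*} [NormedAddCommGroup H] [InnerProductSpace ℂ H] [CompleteSpace H]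
variable {T : H →L[ℂ] H} {θ : ℕ → HInfty} {f g : Set ℕ → HInfty} {A B : Set ℕ}

/-- For class `C₀` the strong limit always exists, so the default value in `hInftyCalc` never
intervenes. -/
theorem IsClassC0.isHInftyValue (hT : IsClassC0 T) (u : HInfty) :
    IsHInftyValue T u (hInftyCalc T u) := by
  obtain ⟨X, hX⟩ := exists_isHInftyValue hT.1 hT.tendsto_pow u
  rwa [hX.hInftyCalc_eq]

theorem IsClassC0.hInftyCalc_sub (hT : IsClassC0 T) (u v : HInfty) :
    hInftyCalc T (u - v) = hInftyCalc T u - hInftyCalc T v :=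
  ((hT.isHInftyValue u).sub hT.1 (hT.isHInftyValue v)).hInftyCalc_eq

theorem IsClassC0.hInftyCalc_mul (hT : IsClassC0 T) (u v : HInfty) :
    hInftyCalc T (u * v) = hInftyCalc T u * hInftyCalc T v :=
  ((hT.isHInftyValue u).mul hT.1 (hT.isHInftyValue v)).hInftyCalc_eq

omit [CompleteSpace H] in
theorem hInftyCalc_one : hInftyCalc T 1 = 1 := (isHInftyValue_one T).hInftyCalc_eq

omit [CompleteSpace H] in
theorem IsMinimalFunction.hInftyCalc_eq_zero {m u : HInfty} (hm : IsMinimalFunction T m)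
    (h : m ∣ u) : hInftyCalc T u = 0 := ((hm.2 u).2 h).hInftyCalc_eq

theorem IsMinimalFunction.hInftyCalc_eq {m u v : HInfty} (hT : IsClassC0 T)
    (hm : IsMinimalFunction T m) (h : m ∣ u - v) : hInftyCalc T u = hInftyCalc T v := by
  have := hm.hInftyCalc_eq_zero h
  rwa [hT.hInftyCalc_sub, sub_eq_zero] at this

theorem hInftyCalc_eq_of_isBezoutPair (hT : IsClassC0 T) (hθ : ∀ n, IsInner (θ n))
    (hprod : ∃ u, IsProductOver θ Set.univ u)
    (hmin : IsMinimalFunction T (thetaProd θ Set.univ)) (hA : FinOrCofin A) {a b a' b' : HInfty}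
    (h : IsBezoutPair θ A a b) (h' : IsBezoutPair θ A a' b') :
    hInftyCalc T (b' * coTheta θ A) = hInftyCalc T (b * coTheta θ A) := by
  refine hmin.hInftyCalc_eq hT ?_
  rw [IsBezoutPair] at h h'
  have := mul_dvd_sub_mul_of_bezout h h'
  rwa [coTheta_eq hθ hprod hmin.1.ne_zero hA, thetaProd_mul_compl hθ hprod hA] at *

/-- Passing to the complement exchanges `θ_A` with `θ / θ_A`, hence `f` with `g`; this carries the
Carleson condition from finite to cofinite sets. -/
theorem IsBezoutPair.compl (hθ : ∀ n, IsInner (θ n)) (hprod : ∃ u, IsProductOver θ Set.univ u)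
    (h0 : thetaProd θ Set.univ ≠ 0) (hA : FinOrCofin A) {a b : HInfty}
    (h : IsBezoutPair θ A a b) : IsBezoutPair θ Aᶜ b a := by
  rw [IsBezoutPair, coTheta_eq hθ hprod h0 hA] at h
  rw [IsBezoutPair, coTheta_eq hθ hprod h0 hA.compl, compl_compl, add_comm]
  exact h

theorem phiOp_mul_phiOp (hT : IsClassC0 T) (hθ : ∀ n, IsInner (θ n))
    (hprod : ∃ u, IsProductOver θ Set.univ u)
    (hmin : IsMinimalFunction T (thetaProd θ Set.univ))
    (hfg : ∀ A, FinOrCofin A → IsBezoutPair θ A (f A) (g A))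
    (hA : FinOrCofin A) (hB : FinOrCofin B) :
    phiOp T θ g A * phiOp T θ g B = phiOp T θ g (A ∩ B) := by
  have hI := hA.inter hB
  have h0 := hmin.1.ne_zero
  rw [phiOp, phiOp, phiOp, ← hT.hInftyCalc_mul]
  refine hmin.hInftyCalc_eq hT ?_
  have bA := hfg A hA
  have bB := hfg B hB
  have bI := hfg _ hI
  rw [IsBezoutPair, coTheta_eq hθ hprod h0 hA] at bA
  rw [IsBezoutPair, coTheta_eq hθ hprod h0 hB] at bB
  rw [IsBezoutPair, coTheta_eq hθ hprod h0 hI] at bI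
  rw [coTheta_eq hθ hprod h0 hA, coTheta_eq hθ hprod h0 hB, coTheta_eq hθ hprod h0 hI]
  have d1 : thetaProd θ Set.univ ∣ thetaProd θ Aᶜ * thetaProd θ Bᶜ * thetaProd θ (A ∩ B) := by
    rw [← thetaProd_mul_compl hθ hprod hI, mul_comm, Set.compl_inter]
    exact mul_dvd_mul_right (thetaProd_union_dvd hθ hprod hA.compl hB.compl) _
  have d2 : thetaProd θ Set.univ ∣ thetaProd θ A * thetaProd θ (A ∩ B)ᶜ := by
    rw [← thetaProd_mul_compl hθ hprod hA]
    exact mul_dvd_mul_left _ (thetaProd_dvd_of_subset hθ hprod hA.compl hI.compl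
      (Set.compl_subset_compl.2 Set.inter_subset_left))
  have d3 : thetaProd θ Set.univ ∣ thetaProd θ B * thetaProd θ (A ∩ B)ᶜ := by
    rw [← thetaProd_mul_compl hθ hprod hB]
    exact mul_dvd_mul_left _ (thetaProd_dvd_of_subset hθ hprod hB.compl hI.compl
      (Set.compl_subset_compl.2 Set.inter_subset_right))
  -- With `I = A ∩ B`, this is `φ_A φ_B - φ_I = φ_A φ_B (1 - φ_I) - φ_I (1 - φ_A) - φ_I φ_A (1 -
  -- φ_B)`, where `1 - φ_S = f_S θ_S`. Each term contains a product divisible by `θ`.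
  have e : g A * thetaProd θ Aᶜ * (g B * thetaProd θ Bᶜ) - g (A ∩ B) * thetaProd θ (A ∩ B)ᶜ
      = (g A * g B * f (A ∩ B)) * (thetaProd θ Aᶜ * thetaProd θ Bᶜ * thetaProd θ (A ∩ B))
        - (g (A ∩ B) * f A) * (thetaProd θ A * thetaProd θ (A ∩ B)ᶜ)
        - (g (A ∩ B) * (g A * thetaProd θ Aᶜ) * f B) * (thetaProd θ B * thetaProd θ (A ∩ B)ᶜ) := by
    linear_combination (-(g A * thetaProd θ Aᶜ * (g B * thetaProd θ Bᶜ))) * bI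
      + (g (A ∩ B) * thetaProd θ (A ∩ B)ᶜ) * bA
      + (g (A ∩ B) * thetaProd θ (A ∩ B)ᶜ * (g A * thetaProd θ Aᶜ)) * bB
  rw [e]
  exact dvd_sub (dvd_sub (d1.mul_left _) (d2.mul_left _)) (d3.mul_left _)

theorem phiOp_compl (hT : IsClassC0 T) (hθ : ∀ n, IsInner (θ n))
    (hprod : ∃ u, IsProductOver θ Set.univ u)
    (hmin : IsMinimalFunction T (thetaProd θ Set.univ))
    (hfg : ∀ A, FinOrCofin A → IsBezoutPair θ A (f A) (g A)) (hA : FinOrCofin A) :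
    phiOp T θ g Aᶜ = 1 - phiOp T θ g A := by
  have h0 := hmin.1.ne_zero
  have h1 := hInftyCalc_eq_of_isBezoutPair hT hθ hprod hmin hA.compl
    ((hfg A hA).compl hθ hprod h0 hA) (hfg _ hA.compl)
  rw [phiOp, h1, phiOp, ← hInftyCalc_one (T := T), ← hT.hInftyCalc_sub]
  congr 1
  rw [coTheta_eq hθ hprod h0 hA.compl, compl_compl, eq_sub_iff_add_eq]
  exact hfg A hA

omit [CompleteSpace H] in
theorem phiOp_empty (hθ : ∀ n, IsInner (θ n)) (hprod : ∃ u, IsProductOver θ Set.univ u)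
    (hmin : IsMinimalFunction T (thetaProd θ Set.univ)) : phiOp T θ g ∅ = 0 := by
  refine hmin.hInftyCalc_eq_zero ?_
  rw [coTheta_eq hθ hprod hmin.1.ne_zero finOrCofin_empty, Set.compl_empty]
  exact Dvd.intro_left _ rfl

theorem phiOp_compl_symmDiff (hT : IsClassC0 T) (hθ : ∀ n, IsInner (θ n))
    (hprod : ∃ u, IsProductOver θ Set.univ u)
    (hmin : IsMinimalFunction T (thetaProd θ Set.univ))
    (hfg : ∀ A, FinOrCofin A → IsBezoutPair θ A (f A) (g A))
    (hA : FinOrCofin A) (hB : FinOrCofin B) :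
    phiOp T θ g (A ∆ B)ᶜ
      = 1 - phiOp T θ g A - phiOp T θ g B + (2 : ℂ) • (phiOp T θ g A * phiOp T θ g B) := by
  -- The set is the disjoint union of `A ∩ B` and `Aᶜ ∩ Bᶜ`, expressed by intersections and
  -- complements, for which rules are known. Hence its idempotent is `φ_A φ_B + (1 - φ_A)(1 - φ_B)`.
  have hset : (A ∆ B)ᶜ = ((A ∩ B)ᶜ ∩ (Aᶜ ∩ Bᶜ)ᶜ)ᶜ := by
    ext n
    simp only [Set.mem_compl_iff, Set.mem_symmDiff, Set.mem_inter_iff]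
    tauto
  have hI := hA.inter hB
  have hJ := hA.compl.inter hB.compl
  have hIJ : phiOp T θ g (A ∩ B) * phiOp T θ g (Aᶜ ∩ Bᶜ) = 0 := by
    rw [phiOp_mul_phiOp hT hθ hprod hmin hfg hI hJ, ← phiOp_empty hθ hprod hmin (g := g)]
    congr 1
    ext n
    simp only [Set.mem_inter_iff, Set.mem_compl_iff, Set.mem_empty_iff_false]
    tauto
  have hJ' : phiOp T θ g (Aᶜ ∩ Bᶜ) = 1 - phiOp T θ g A - phiOp T θ g B
      + phiOp T θ g A * phiOp T θ g B := by
    rw [← phiOp_mul_phiOp hT hθ hprod hmin hfg hA.compl hB.compl,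
      phiOp_compl hT hθ hprod hmin hfg hA, phiOp_compl hT hθ hprod hmin hfg hB]
    noncomm_ring
  rw [hset, phiOp_compl hT hθ hprod hmin hfg (hI.compl.inter hJ.compl),
    ← phiOp_mul_phiOp hT hθ hprod hmin hfg hI.compl hJ.compl,
    phiOp_compl hT hθ hprod hmin hfg hI, phiOp_compl hT hθ hprod hmin hfg hJ,
    sub_mul, one_mul, mul_sub, mul_one, hIJ, sub_zero, hJ',
    ← phiOp_mul_phiOp hT hθ hprod hmin hfg hA hB, two_smul]
  abel

theorem kOp_mul_kOp (hT : IsClassC0 T) (hθ : ∀ n, IsInner (θ n))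
    (hprod : ∃ u, IsProductOver θ Set.univ u)
    (hmin : IsMinimalFunction T (thetaProd θ Set.univ))
    (hfg : ∀ A, FinOrCofin A → IsBezoutPair θ A (f A) (g A))
    (hA : FinOrCofin A) (hB : FinOrCofin B) :
    kOp T θ g A * kOp T θ g B = kOp T θ g (A ∆ B)ᶜ := by
  rw [kOp, kOp, kOp, phiOp_compl_symmDiff hT hθ hprod hmin hfg hA hB]
  simp only [two_smul]
  noncomm_ring

theorem kOp_univ (hT : IsClassC0 T) (hθ : ∀ n, IsInner (θ n))
    (hprod : ∃ u, IsProductOver θ Set.univ u)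
    (hmin : IsMinimalFunction T (thetaProd θ Set.univ))
    (hfg : ∀ A, FinOrCofin A → IsBezoutPair θ A (f A) (g A)) : kOp T θ g Set.univ = 1 := by
  rw [kOp, ← Set.compl_empty, phiOp_compl hT hθ hprod hmin hfg finOrCofin_empty,
    phiOp_empty hθ hprod hmin, sub_zero, two_smul, add_sub_cancel_right]

theorem kOp_mul_self (hT : IsClassC0 T) (hθ : ∀ n, IsInner (θ n))
    (hprod : ∃ u, IsProductOver θ Set.univ u)
    (hmin : IsMinimalFunction T (thetaProd θ Set.univ))
    (hfg : ∀ A, FinOrCofin A → IsBezoutPair θ A (f A) (g A)) (hA : FinOrCofin A) :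
    kOp T θ g A * kOp T θ g A = 1 := by
  rw [kOp_mul_kOp hT hθ hprod hmin hfg hA hA, symmDiff_self, Set.bot_eq_empty, Set.compl_empty,
    kOp_univ hT hθ hprod hmin hfg]

/-- The group of the operators `k_A`. -/
def kGroup (hT : IsClassC0 T) (hθ : ∀ n, IsInner (θ n))
    (hprod : ∃ u, IsProductOver θ Set.univ u)
    (hmin : IsMinimalFunction T (thetaProd θ Set.univ))
    (hfg : ∀ A, FinOrCofin A → IsBezoutPair θ A (f A) (g A)) : Subgroup (H →L[ℂ] H)ˣ where
  carrier := {U | ∃ A, FinOrCofin A ∧ (U : H →L[ℂ] H) = kOp T θ g A}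
  mul_mem' := by
    rintro U V ⟨A, hA, hU⟩ ⟨B, hB, hV⟩
    exact ⟨(A ∆ B)ᶜ, (hA.symmDiff hB).compl, by
      rw [Units.val_mul, hU, hV, kOp_mul_kOp hT hθ hprod hmin hfg hA hB]⟩
  one_mem' := ⟨Set.univ, finOrCofin_univ, by
    rw [Units.val_one, kOp_univ hT hθ hprod hmin hfg]⟩
  inv_mem' := by
    rintro U ⟨A, hA, hU⟩
    refine ⟨A, hA, ?_⟩
    have : U * U = 1 := Units.ext (by
      rw [Units.val_mul, hU, kOp_mul_self hT hθ hprod hmin hfg hA, Units.val_one])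
    rw [inv_eq_of_mul_eq_one_left this, hU]

end Projections

end

theorem lemma4p2 {H : Type*} [NormedAddCommGroup H] [InnerProductSpace ℂ H] [CompleteSpace H]
    (T : H →L[ℂ] H) (hT : IsClassC0 T)
    (θ : ℕ → HInfty) (hθ : ∀ n, IsInner (θ n))
    (hprod : ∃ u, IsProductOver θ Set.univ u)
    (hmin : IsMinimalFunction T (thetaProd θ Set.univ))
    (C : ℝ) (hC : GeneralizedCarleson θ C) :
    -- `θ_A` and `θ / θ_A` make sense, and admissible `f_A`, `g_A` bounded by `C` exist
    (∀ A, FinOrCofin A →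
      IsProductOver θ A (thetaProd θ A) ∧
      thetaProd θ A ≠ 0 ∧
      thetaProd θ A * coTheta θ A = thetaProd θ Set.univ ∧
      ∃ f g : HInfty, IsBezoutPair θ A f g ∧ supNorm f ≤ C ∧ supNorm g ≤ C) ∧
    -- `φ_A(T)` exists and does not depend on the choice of `f_A`, `g_A`
    (∀ A, FinOrCofin A → ∀ f g : HInfty, IsBezoutPair θ A f g →
      IsHInftyValue T (g * coTheta θ A) (hInftyCalc T (g * coTheta θ A)) ∧
      ∀ f' g' : HInfty, IsBezoutPair θ A f' g' →
        hInftyCalc T (g' * coTheta θ A) = hInftyCalc T (g * coTheta θ A)) ∧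
    -- the algebraic relations, for every admissible choice of the `f_A`, `g_A`
    (∀ f g : Set ℕ → HInfty, (∀ A, FinOrCofin A → IsBezoutPair θ A (f A) (g A)) →
      (∀ A B, FinOrCofin A → FinOrCofin B →
        phiOp T θ g A * phiOp T θ g B = phiOp T θ g (A ∩ B)) ∧
      (∀ A, FinOrCofin A → kOp T θ g A * kOp T θ g A = 1) ∧
      (∀ A B, FinOrCofin A → FinOrCofin B →
        kOp T θ g A * kOp T θ g B = kOp T θ g (A ∆ B)ᶜ) ∧
      ∃ G : Subgroup (H →L[ℂ] H)ˣ,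
        {X : H →L[ℂ] H | ∃ U ∈ G, (U : H →L[ℂ] H) = X} = {X | ∃ A, FinOrCofin A ∧ X = kOp T θ g A} ∧
        ∀ U ∈ G, ∀ V ∈ G, U * V = V * U) := by
  have h0 := hmin.1.ne_zero
  refine ⟨fun A hA => ⟨isProductOver_thetaProd hθ hprod hA, thetaProd_ne_zero hθ hprod h0 hA, ?_, ?_⟩,
    fun A hA f g h => ⟨hT.isHInftyValue _, fun f' g' h' =>
      hInftyCalc_eq_of_isBezoutPair hT hθ hprod hmin hA h h'⟩,
    fun f g hfg => ⟨fun A B hA hB => phiOp_mul_phiOp hT hθ hprod hmin hfg hA hB,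
      fun A hA => kOp_mul_self hT hθ hprod hmin hfg hA,
      fun A B hA hB => kOp_mul_kOp hT hθ hprod hmin hfg hA hB,
      kGroup hT hθ hprod hmin hfg, ?_, ?_⟩⟩
  · rw [coTheta_eq hθ hprod h0 hA, thetaProd_mul_compl hθ hprod hA]
  · rcases hA with hA | hA
    · exact hC.2 A hA
    -- For cofinite `A`, take the pair for the finite complement and swap it; the bounds are
    -- symmetric.
    · obtain ⟨f, g, h, hf, hg⟩ := hC.2 _ hA
      have h' := h.compl hθ hprod h0 (Or.inl hA)
      rw [compl_compl] at h'
      exact ⟨g, f, h', hg, hf⟩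
  · ext X
    constructor
    · rintro ⟨U, ⟨A, hA, hU⟩, rfl⟩
      exact ⟨A, hA, hU⟩
    · rintro ⟨A, hA, rfl⟩
      have h := kOp_mul_self hT hθ hprod hmin hfg hA
      exact ⟨⟨kOp T θ g A, kOp T θ g A, h, h⟩, ⟨A, hA, rfl⟩, rfl⟩
  · rintro U ⟨A, hA, hU⟩ V ⟨B, hB, hV⟩
    refine Units.ext ?_
    rw [Units.val_mul, Units.val_mul, hU, hV, kOp_mul_kOp hT hθ hprod hmin hfg hA hB,
      kOp_mul_kOp hT hθ hprod hmin hfg hB hA, symmDiff_comm]
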